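/- Let $G$ be a connected simple graph with at least two vertices (finite or infinite), and suppose that $G$ is wheel-free, i.e. for every $n\ge 3$ it has no subgraph isomorphic to the wheel $W_n$, the cone over the cycle graph $C_n$. Let $\Delta L(G)$ be the clique complex of the line graph of $G$: its vertices are the edges of $G$, and its simplices are the finite sets of edges any two of which share an endpoint. Then (the geometric realization of) $\Delta L(G)$ is homotopy equivalent to a wedge of circles, where the wedge of the empty family of circles is a point. -/

import Mathlib

universe u

/-- The cone over a graph `G`: a new vertex `none` (the apex) is joined to every vertex of `G`. -/
def SimpleGraph.coneGraph {V : Type*} (G : SimpleGraph V) : SimpleGraph (Option V) where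
  Adj
    | none, none => False
    | none, some _ => True
    | some _, none => True
    | some v, some w => G.Adj v w
  symm := ⟨by
    rintro (_ | v) (_ | w) h
    · exact h
    · exact h
    · exact h
    · exact G.adj_symm h⟩
  loopless := ⟨by
    rintro (_ | v) h
    · exact h
    · exact G.irrefl h⟩

/-- The wheel graph `W n` on `n + 1` vertices: the cone over the cycle graph on `n` vertices
(a wheel in the usual sense for `3 ≤ n`). -/
def wheelGraph (n : ℕ) : SimpleGraph (Option (Fin n)) :=
  (SimpleGraph.cycleGraph n).coneGraph

/-- A graph is wheel-free if it has no (not necessarily induced) subgraph isomorphic to a wheel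
`W n` with `3 ≤ n`. -/
def SimpleGraph.WheelFree {V : Type*} (G : SimpleGraph V) : Prop :=
  ∀ n : ℕ, 3 ≤ n → (wheelGraph n).Free G

/-- The clique complex of a graph: its simplices are the nonempty finite sets of pairwise adjacent
vertices. (The empty simplex, which does not contribute to the realization, is left out, as in
Mathlib's notion of an abstract simplicial complex.) -/
def SimpleGraph.cliqueComplex {V : Type*} (G : SimpleGraph V) : AbstractSimplicialComplex V where
  faces := {s | s.Nonempty ∧ G.IsClique (s : Set V)}
  isRelLowerSet_faces := fun _ hs =>
    ⟨hs.1, fun _ hts ht => ⟨ht, hs.2.subset (Finset.coe_subset.mpr hts)⟩⟩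
  singleton_mem := fun v => ⟨Finset.singleton_nonempty v, by simp⟩

/-- The points of the geometric realization of a simplicial complex, in barycentric coordinates:
nonnegative functions on the vertices that vanish off some face and have total mass one. -/
@[ext]
structure GeometricRealization {V : Type*} (K : PreAbstractSimplicialComplex V) where
  /-- the barycentric coordinates -/
  coord : V → ℝ
  nonneg : ∀ v, 0 ≤ coord v
  exists_face : ∃ s ∈ K.faces, (∀ v, v ∉ s → coord v = 0) ∧ ∑ v ∈ s, coord v = 1

namespace GeometricRealization

open Classical in
/-- The closed simplex spanned by the face `s`, as a map from the standard simplex with vertex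
set `s` into the geometric realization (extension of barycentric coordinates by zero). -/
noncomputable def ofFace {V : Type*} (K : PreAbstractSimplicialComplex V) (s : K.faces)
    (x : stdSimplex ℝ s.1) : GeometricRealization K where
  coord v := if h : v ∈ s.1 then x.1 ⟨v, h⟩ else 0
  nonneg v := by
    by_cases h : v ∈ s.1
    · simpa [h] using x.2.1 ⟨v, h⟩
    · simp [h]
  exists_face := by
    refine ⟨s.1, s.2, fun v hv => by simp [hv], ?_⟩
    rw [← Finset.sum_coe_sort]
    simpa using x.2.2

/-- The weak topology on the geometric realization: a set is open if and only if its intersection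
with every closed simplex is open in the Euclidean topology of that simplex. -/
noncomputable instance {V : Type*} (K : PreAbstractSimplicialComplex V) :
    TopologicalSpace (GeometricRealization K) :=
  ⨆ s : K.faces, TopologicalSpace.coinduced (ofFace K s) inferInstance

end GeometricRealization

/-- The space `ΔL(G)`: the geometric realization of the clique complex of the line graph of `G`. -/
abbrev SimpleGraph.DeltaL {V : Type*} (G : SimpleGraph V) : Type _ :=
  GeometricRealization G.lineGraph.cliqueComplex.toPreAbstractSimplicialComplex

/-- The identification that forms the wedge: the base point `1` of every circle is identified with
one common point. -/
inductive WedgeRel (ι : Type*) : (Unit ⊕ (Σ _ : ι, Circle)) → (Unit ⊕ (Σ _ : ι, Circle)) → Prop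
  | base (i : ι) : WedgeRel ι (Sum.inr ⟨i, 1⟩) (Sum.inl ())

/-- The wedge of a family of circles indexed by `ι`: the quotient, with the quotient topology, of
the disjoint union of a point and of the circles in which all base points are identified with
that point. It is a single point when `ι` is empty. -/
def WedgeOfCircles (ι : Type*) : Type _ := Quot (WedgeRel ι)

instance (ι : Type*) : TopologicalSpace (WedgeOfCircles ι) :=
  inferInstanceAs (TopologicalSpace (Quot (WedgeRel ι)))

/-! Pairwise meeting edges of a simple graph either share a vertex or are the three sides of a
triangle. So the complex is the union of one full, possibly infinite, simplex for every vertex `v`,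
spanned by the star of `v`, and of the triangles of `G`. Two star simplices share at most one
vertex, and a triangle meets the star simplex at each of its corners in a segment. The segments at
`v` form the link of `v`, a graph on the star. A cycle in the link is the rim of a wheel with hub
`v`, so wheel-freeness makes every link a forest (`WheelFree.isAcyclic_linkGraph`).

Extend every link to a tree on the star. A simplex retracts onto a tree on its vertices by an
explicit formula (`ParentTree.retract`) that fixes the tree. These retractions fix the common
vertices of stars and the sides of the triangles, hence they glue (`homotopyEquiv_treeGraph`). Trees
and triangles remain. A side of a triangle determines the triangle, so all triangles can be
collapsed at once, each from one side (`homotopyEquiv_collapsedGraph`). This leaves a connected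
triangle-free graph, and contracting a spanning tree in it gives the wedge (`homotopyEquiv_wedge`).

No finiteness is available, so maps are given in barycentric coordinates and continuity is tested on
one closed simplex at a time, each of which goes into finitely many coordinates. `StarSystem`
isolates the combinatorics of stars and triangles that the retractions need. -/

open Topology unitInterval

/-! ### Continuity criteria for the weak topology -/

namespace GeometricRealization

section Topology

variable {V : Type*} {K : PreAbstractSimplicialComplex V}

theorem coord_ofFace_of_mem (s : K.faces) (x : stdSimplex ℝ s.1) {v : V} (hv : v ∈ s.1) :
    (ofFace K s x).coord v = x.1 ⟨v, hv⟩ := by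
  simp [ofFace, hv]

theorem coord_ofFace_of_notMem (s : K.faces) (x : stdSimplex ℝ s.1) {v : V} (hv : v ∉ s.1) :
    (ofFace K s x).coord v = 0 := by
  simp [ofFace, hv]

theorem sum_coord_ofFace (s : K.faces) (x : stdSimplex ℝ s.1) :
    ∑ v ∈ s.1, (ofFace K s x).coord v = 1 := by
  rw [← Finset.sum_coe_sort, ← x.2.2]
  exact Finset.sum_congr rfl fun v _ => coord_ofFace_of_mem s x v.2

theorem exists_eq_ofFace_of_support (x : GeometricRealization K) {s : Finset V} (hs : s ∈ K.faces)
    (h0 : ∀ v, v ∉ s → x.coord v = 0) (h1 : ∑ v ∈ s, x.coord v = 1) :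
    ∃ y, ofFace K ⟨s, hs⟩ y = x := by
  refine ⟨⟨fun v => x.coord v, fun v => x.nonneg v, ?_⟩, ?_⟩
  · rw [Finset.sum_coe_sort s (fun v => x.coord v), h1]
  · ext v
    by_cases hv : v ∈ s
    · rw [coord_ofFace_of_mem _ _ hv]
    · rw [coord_ofFace_of_notMem _ _ hv, h0 v hv]

theorem exists_eq_ofFace (x : GeometricRealization K) : ∃ s y, ofFace K s y = x := by
  obtain ⟨s, hs, h0, h1⟩ := x.exists_face
  exact ⟨⟨s, hs⟩, x.exists_eq_ofFace_of_support hs h0 h1⟩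

theorem sum_coord_eq_one (x : GeometricRealization K) {s : Finset V}
    (h0 : ∀ v, v ∉ s → x.coord v = 0) : ∑ v ∈ s, x.coord v = 1 := by
  classical
  obtain ⟨t, ht, h0', h1⟩ := x.exists_face
  have e1 : ∑ v ∈ s, x.coord v = ∑ v ∈ s ∪ t, x.coord v :=
    Finset.sum_subset Finset.subset_union_left fun v _ hv => h0 v hv
  have e2 : ∑ v ∈ t, x.coord v = ∑ v ∈ s ∪ t, x.coord v :=
    Finset.sum_subset Finset.subset_union_right fun v _ hv => h0' v hv
  rw [e1, ← e2, h1]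

theorem exists_pos (x : GeometricRealization K) : ∃ v, 0 < x.coord v := by
  obtain ⟨s, -, -, h1⟩ := x.exists_face
  obtain ⟨v, -, hv⟩ := Finset.exists_ne_zero_of_sum_ne_zero (h1.trans_ne one_ne_zero)
  exact ⟨v, lt_of_le_of_ne (x.nonneg v) hv.symm⟩

/-- The carrier of a point: the face of its nonzero coordinates. -/
theorem exists_carrier (x : GeometricRealization K) :
    ∃ s ∈ K.faces, ∀ v, v ∈ s ↔ 0 < x.coord v := by
  classical
  obtain ⟨s, hs, h0, h1⟩ := x.exists_face
  have key : ∀ v, v ∈ s.filter (fun v => 0 < x.coord v) ↔ 0 < x.coord v := fun v => by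
    rw [Finset.mem_filter, and_iff_right_iff_imp]
    intro hv
    by_contra h
    exact hv.ne' (h0 v h)
  refine ⟨_, (K.isRelLowerSet_faces hs).2 (Finset.filter_subset _ s) ?_, key⟩
  obtain ⟨v, hv⟩ := x.exists_pos
  exact ⟨v, (key v).2 hv⟩

theorem coord_eq_zero_of_not_pos (x : GeometricRealization K) {v : V} (h : ¬ 0 < x.coord v) :
    x.coord v = 0 :=
  le_antisymm (not_lt.1 h) (x.nonneg v)

theorem continuous_iff {Y : Type*} [TopologicalSpace Y] {f : GeometricRealization K → Y} :
    Continuous f ↔ ∀ s, Continuous (f ∘ ofFace K s) := by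
  rw [continuous_iSup_dom]
  exact forall_congr' fun s => continuous_coinduced_dom

theorem continuous_ofFace (s : K.faces) : Continuous (ofFace K s) :=
  continuous_iff.1 continuous_id s

theorem continuous_coord_ofFace (s : K.faces) (v : V) :
    Continuous fun x => (ofFace K s x).coord v := by
  by_cases hv : v ∈ s.1
  · simp only [coord_ofFace_of_mem _ _ hv]
    exact (continuous_apply _).comp continuous_subtype_val
  · simp only [coord_ofFace_of_notMem _ _ hv]
    exact continuous_const

theorem continuous_coord (v : V) : Continuous fun x : GeometricRealization K => x.coord v :=
  continuous_iff.2 fun s => continuous_coord_ofFace s v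

/-- On the points supported in a fixed finite set of vertices, the weak topology is the topology
of coordinatewise convergence. -/
theorem continuous_of_finite_support {Z : Type*} [TopologicalSpace Z]
    {φ : Z → GeometricRealization K} (F : Finset V) (hF : ∀ z v, v ∉ F → (φ z).coord v = 0)
    (hφ : ∀ v, Continuous fun z => (φ z).coord v) : Continuous φ := by
  classical
  -- `C` is a finite union of closed simplices, hence compact. The coordinates inject it
  -- continuously into a Hausdorff space, so they embed it.
  let C : Set (GeometricRealization K) := {y | ∀ v, v ∉ F → y.coord v = 0}
  have hC : C = ⋃ s : {s : K.faces // s.1 ⊆ F}, Set.range (ofFace K s.1) := by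
    ext y
    simp only [C, Set.mem_ofPred_eq, Set.mem_iUnion, Set.mem_range]
    constructor
    · intro hy
      obtain ⟨s, hs, h⟩ := y.exists_carrier
      have h0 : ∀ v, v ∉ s → y.coord v = 0 := fun v hv =>
        y.coord_eq_zero_of_not_pos fun h' => hv ((h v).2 h')
      refine ⟨⟨⟨s, hs⟩, fun v hv => ?_⟩,
        y.exists_eq_ofFace_of_support hs h0 (y.sum_coord_eq_one h0)⟩
      by_contra hvF
      exact ((h v).1 hv).ne' (hy v hvF)
    · rintro ⟨s, x, rfl⟩ v hv
      exact coord_ofFace_of_notMem _ _ fun h => hv (s.2 h)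
  have hfin : Finite {s : K.faces // s.1 ⊆ F} :=
    Finite.of_injective (β := {s : Finset V // s ∈ F.powerset})
      (fun s => ⟨s.1.1, Finset.mem_powerset.2 s.2⟩) fun s t h => by
        simpa [Subtype.ext_iff] using h
  have hcomp : IsCompact C := by
    rw [hC]
    exact isCompact_iUnion fun s => isCompact_range (continuous_ofFace s.1)
  have : CompactSpace C := isCompact_iff_compactSpace.1 hcomp
  let c : C → V → ℝ := fun y v => y.1.coord v
  have hc : Continuous c :=
    continuous_pi fun v => (continuous_coord v).comp continuous_subtype_val
  have hinj : Function.Injective c := fun y z h => by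
    apply Subtype.ext
    ext v
    exact congrFun h v
  have hemb := hc.isClosedEmbedding hinj
  let ψ : Z → C := fun z => ⟨φ z, hF z⟩
  have hψ : Continuous ψ := hemb.isInducing.continuous_iff.2 (continuous_pi hφ)
  exact continuous_subtype_val.comp hψ

/-- A homotopy on a realization is continuous if it is continuous on every closed simplex. -/
theorem continuous_prod {Y J : Type*} [TopologicalSpace Y] [TopologicalSpace J]
    [LocallyCompactSpace J] {H : GeometricRealization K × J → Y}
    (h : ∀ s, Continuous fun p : stdSimplex ℝ s.1 × J => H (ofFace K s p.1, p.2)) :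
    Continuous H := by
  have h1 : ∀ x, Continuous fun t => H (x, t) := fun x => by
    obtain ⟨s, y, rfl⟩ := x.exists_eq_ofFace
    exact (h s).comp (Continuous.prodMk_right y)
  -- Whether the product carries the weak topology is avoided by currying: a map into `C(J, Y)` can
  -- be tested on simplices, and local compactness of `J` allows uncurrying.
  let Φ : GeometricRealization K → C(J, Y) := fun x => ⟨fun t => H (x, t), h1 x⟩
  have hΦ : Continuous Φ := continuous_iff.2 fun s =>
    (ContinuousMap.curry (⟨_, h s⟩ : C(stdSimplex ℝ s.1 × J, Y))).continuous
  exact ContinuousMap.continuous_uncurry_of_continuous ⟨Φ, hΦ⟩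

end Topology

/-! ### Straight-line homotopies and retractions -/

section Homotopy

variable {V V' : Type*} {K : PreAbstractSimplicialComplex V} {K' : PreAbstractSimplicialComplex V'}

/-- The coordinates of a map between realizations are continuous on every closed simplex, and
every closed simplex is mapped into finitely many coordinates. -/
def FaceContinuous (c : GeometricRealization K → V' → ℝ) : Prop :=
  ∀ s, ∃ F : Finset V', (∀ y v, v ∉ F → c (ofFace K s y) v = 0) ∧
    ∀ v, Continuous fun y => c (ofFace K s y) v

theorem FaceContinuous.continuous {f : GeometricRealization K → GeometricRealization K'}
    (hf : FaceContinuous fun x => (f x).coord) : Continuous f :=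
  continuous_iff.2 fun s => by
    obtain ⟨F, hF, hc⟩ := hf s
    exact continuous_of_finite_support F hF hc

theorem faceContinuous_coord : FaceContinuous (K := K) fun x => x.coord := fun s =>
  ⟨s.1, fun y _ hv => coord_ofFace_of_notMem s y hv, continuous_coord_ofFace s⟩

/-- The straight-line homotopy between two maps that send every point into a common face. -/
theorem homotopic_of_common_face (f g : C(GeometricRealization K, GeometricRealization K'))
    (hf : FaceContinuous fun x => (f x).coord) (hg : FaceContinuous fun x => (g x).coord)
    (h : ∀ x, ∃ t ∈ K'.faces, ∀ v, v ∉ t → (f x).coord v = 0 ∧ (g x).coord v = 0) :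
    f.Homotopic g := by
  classical
  let H : GeometricRealization K × I → GeometricRealization K' := fun p =>
    { coord := fun v => (1 - (p.2 : ℝ)) * (f p.1).coord v + p.2 * (g p.1).coord v
      nonneg := fun v => add_nonneg (mul_nonneg (sub_nonneg.2 p.2.2.2) ((f p.1).nonneg v))
        (mul_nonneg p.2.2.1 ((g p.1).nonneg v))
      exists_face := by
        obtain ⟨t, ht, h0⟩ := h p.1
        refine ⟨t, ht, fun v hv => by simp [h0 v hv], ?_⟩
        rw [Finset.sum_add_distrib, ← Finset.mul_sum, ← Finset.mul_sum,
          sum_coord_eq_one _ fun v hv => (h0 v hv).1, sum_coord_eq_one _ fun v hv => (h0 v hv).2]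
        ring }
  have hH : Continuous H := continuous_prod fun s => by
    obtain ⟨F, hF, hfc⟩ := hf s
    obtain ⟨F', hF', hgc⟩ := hg s
    refine continuous_of_finite_support (F ∪ F') (fun z v hv => ?_) fun v => ?_
    · rw [Finset.mem_union, not_or] at hv
      have e1 := hF z.1 v hv.1
      have e2 := hF' z.1 v hv.2
      simp only at e1 e2
      simp [H, e1, e2]
    · have c1 := (hfc v).comp (continuous_fst (X := stdSimplex ℝ s.1) (Y := I))
      have c2 := (hgc v).comp (continuous_fst (X := stdSimplex ℝ s.1) (Y := I))
      have c3 : Continuous fun p : stdSimplex ℝ s.1 × I => (p.2 : ℝ) :=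
        continuous_subtype_val.comp continuous_snd
      exact ((continuous_const.sub c3).mul c1).add (c3.mul c2)
  refine ⟨⟨⟨fun p => H (p.2, p.1), hH.comp continuous_swap⟩, fun x => ?_, fun x => ?_⟩⟩
  · ext v; simp [H]
  · ext v; simp [H]

/-- The inclusion of the realization of a subcomplex. -/
def inclusion {K L : PreAbstractSimplicialComplex V} (h : K.faces ⊆ L.faces)
    (x : GeometricRealization K) : GeometricRealization L :=
  ⟨x.coord, x.nonneg, by
    obtain ⟨s, hs, h'⟩ := x.exists_face
    exact ⟨s, h hs, h'⟩⟩

/-- A retraction onto a subcomplex that moves every point within a face is a homotopy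
equivalence. -/
theorem homotopyEquiv_of_retraction {K L : PreAbstractSimplicialComplex V}
    (h : K.faces ⊆ L.faces) (r : GeometricRealization L → GeometricRealization K)
    (hr : FaceContinuous fun x => (r x).coord)
    (hface : ∀ x, ∃ t ∈ L.faces, ∀ v, v ∉ t → x.coord v = 0 ∧ (r x).coord v = 0)
    (hid : ∀ x, r (inclusion h x) = x) :
    Nonempty (ContinuousMap.HomotopyEquiv (GeometricRealization L) (GeometricRealization K)) := by
  have hi : Continuous (inclusion h) := FaceContinuous.continuous (faceContinuous_coord (K := K))
  let R : C(GeometricRealization L, GeometricRealization K) := ⟨r, hr.continuous⟩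
  let J : C(GeometricRealization K, GeometricRealization L) := ⟨inclusion h, hi⟩
  refine ⟨⟨R, J, ?_, ?_⟩⟩
  · refine (homotopic_of_common_face (.id _) (J.comp R) faceContinuous_coord hr hface).symm
  · have : R.comp J = .id _ := by
      ext1 x
      exact hid x
    rw [this]

end Homotopy

end GeometricRealization

/-! ### Rooted trees and barycentric coordinates -/

/-- A rooted tree, given by its parent map. -/
structure ParentTree (α : Type*) where
  /-- the root -/
  root : α
  /-- the parent map; the root is its own parent -/
  parent : α → α
  /-- the distance to the root -/
  depth : α → ℕ
  parent_root : parent root = root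
  depth_root : depth root = 0
  depth_eq : ∀ v, v ≠ root → depth v = depth (parent v) + 1

/-- Barycentric coordinates: nonnegative, finitely supported and of total mass one. -/
def IsBary {α : Type*} (x : α → ℝ) (s : Finset α) : Prop :=
  (∀ v, 0 ≤ x v) ∧ (∀ v, v ∉ s → x v = 0) ∧ ∑ v ∈ s, x v = 1

namespace IsBary

variable {α : Type*} {x : α → ℝ} {s t : Finset α}

theorem mem_of_pos (hx : IsBary x s) {a : α} (h : 0 < x a) : a ∈ s := by
  by_contra hn
  exact h.ne' (hx.2.1 a hn)

theorem mono (hx : IsBary x s) (h : s ⊆ t) : IsBary x t :=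
  ⟨hx.1, fun v hv => hx.2.1 v fun hv' => hv (h hv'),
    (Finset.sum_subset h fun v _ hv => hx.2.1 v hv).symm.trans hx.2.2⟩

theorem of_support (hx : IsBary x s) (ht : ∀ v, v ∉ t → x v = 0) : IsBary x t := by
  classical
  refine ⟨hx.1, ht, ?_⟩
  have := hx.mono (Finset.subset_union_left (s₂ := t))
  rw [← this.2.2]
  exact Finset.sum_subset Finset.subset_union_right fun v _ hv => ht v hv

open Classical in
theorem coord_eq_sum (hx : IsBary x s) (p : α) : x p = ∑ w ∈ s, if w = p then x w else 0 := by
  rw [Finset.sum_ite_eq']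
  split_ifs with h
  · rfl
  · exact hx.2.1 p h

theorem single [DecidableEq α] (a : α) : IsBary (Pi.single a (1 : ℝ)) {a} :=
  ⟨fun v => by by_cases h : v = a <;> simp [h], fun v hv => by
    simp only [Finset.mem_singleton] at hv
    simp [hv], by simp⟩

theorem le_one (hx : IsBary x s) (v : α) : x v ≤ 1 := by
  by_cases h : v ∈ s
  · rw [← hx.2.2]
    exact Finset.single_le_sum (fun w _ => hx.1 w) h
  · rw [hx.2.1 v h]
    exact zero_le_one

end IsBary

namespace ParentTree

variable {α : Type*} (T : ParentTree α)

/-- `T.Anc u w` says that `u` lies on the path from `w` to the root. -/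
def Anc (u w : α) : Prop := ∃ n : ℕ, T.parent^[n] w = u

variable {T} {u v w : α}

theorem anc_refl (u : α) : T.Anc u u := ⟨0, rfl⟩

theorem Anc.trans (h : T.Anc u v) (h' : T.Anc v w) : T.Anc u w := by
  obtain ⟨n, rfl⟩ := h
  obtain ⟨m, rfl⟩ := h'
  exact ⟨n + m, Function.iterate_add_apply _ _ _ _⟩

theorem anc_parent (w : α) : T.Anc (T.parent w) w := ⟨1, rfl⟩

theorem Anc.eq_or (h : T.Anc u w) : u = w ∨ T.Anc u (T.parent w) := by
  obtain ⟨_ | n, rfl⟩ := h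
  · exact Or.inl rfl
  · exact Or.inr ⟨n, rfl⟩

theorem depth_parent_le (w : α) : T.depth (T.parent w) ≤ T.depth w := by
  by_cases h : w = T.root
  · rw [h, T.parent_root]
  · rw [T.depth_eq w h]
    exact Nat.le_succ _

theorem Anc.depth_le (h : T.Anc u w) : T.depth u ≤ T.depth w := by
  obtain ⟨n, rfl⟩ := h
  induction n with
  | zero => rfl
  | succ n ih =>
    rw [Function.iterate_succ_apply']
    exact (depth_parent_le _).trans ih

theorem Anc.eq_root (h : T.Anc u T.root) : u = T.root := by
  obtain ⟨n, rfl⟩ := h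
  exact Function.iterate_fixed T.parent_root n

theorem Anc.depth_lt (h : T.Anc u w) (hne : u ≠ w) : T.depth u < T.depth w := by
  have hw : w ≠ T.root := by
    rintro rfl
    exact hne h.eq_root
  have := (h.eq_or.resolve_left hne).depth_le
  rw [T.depth_eq w hw]
  omega

theorem Anc.total (h : T.Anc u w) (h' : T.Anc v w) : T.Anc u v ∨ T.Anc v u := by
  obtain ⟨n, rfl⟩ := h
  obtain ⟨m, rfl⟩ := h'
  rcases le_total n m with hnm | hnm
  · obtain ⟨k, rfl⟩ := Nat.exists_eq_add_of_le' hnm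
    exact Or.inr ⟨k, (Function.iterate_add_apply _ _ _ _).symm⟩
  · obtain ⟨k, rfl⟩ := Nat.exists_eq_add_of_le' hnm
    exact Or.inl ⟨k, (Function.iterate_add_apply _ _ _ _).symm⟩

theorem not_anc_parent (hu : u ≠ T.root) : ¬ T.Anc u (T.parent u) := fun h => by
  have h1 := h.depth_le
  have h2 := T.depth_eq u hu
  omega

/-- Induction on the depth. Leaving out the root makes the number of vertices on the path equal to
the depth; this count later bounds the height of a point. -/
theorem exists_ancestors (w : α) : ∃ A : Finset α, (∀ u, u ∈ A ↔ T.Anc u w ∧ u ≠ T.root) ∧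
    A.card = T.depth w ∧ T.Anc T.root w := by
  classical
  induction h : T.depth w generalizing w with
  | zero =>
    have hw : w = T.root := by
      by_contra hne
      have := T.depth_eq w hne
      omega
    subst hw
    exact ⟨∅, fun u => by simpa using fun h => Anc.eq_root h, rfl, anc_refl _⟩
  | succ n ih =>
    have hw : w ≠ T.root := by
      rintro rfl
      rw [T.depth_root] at h
      omega
    have hd : T.depth (T.parent w) = n := by
      have := T.depth_eq w hw
      omega
    obtain ⟨A, hA, hcard, hr⟩ := ih _ hd
    refine ⟨insert w A, fun u => ?_, ?_, hr.trans (anc_parent w)⟩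
    · rw [Finset.mem_insert, hA]
      constructor
      · rintro (rfl | h)
        · exact ⟨anc_refl _, hw⟩
        · exact ⟨h.1.trans (anc_parent w), h.2⟩
      · rintro ⟨h, h'⟩
        exact h.eq_or.imp_right fun h => ⟨h, h'⟩
    · rw [Finset.card_insert_of_notMem, hcard]
      rw [hA]
      exact fun h => not_anc_parent hw h.1

variable (T) in
/-- The vertices other than the root on the path from `w` to the root. -/
noncomputable def ancestors (w : α) : Finset α := (T.exists_ancestors w).choose

theorem mem_ancestors : u ∈ T.ancestors w ↔ T.Anc u w ∧ u ≠ T.root :=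
  (T.exists_ancestors w).choose_spec.1 u

theorem card_ancestors (w : α) : (T.ancestors w).card = T.depth w :=
  (T.exists_ancestors w).choose_spec.2.1

theorem root_anc (w : α) : T.Anc T.root w :=
  (T.exists_ancestors w).choose_spec.2.2

open Classical in
variable (T) in
/-- The vertices other than the root below which some vertex of `s` lies. -/
noncomputable def ancestorsOf (s : Finset α) : Finset α := s.biUnion T.ancestors

theorem mem_ancestorsOf {s : Finset α} :
    u ∈ T.ancestorsOf s ↔ (∃ w ∈ s, T.Anc u w) ∧ u ≠ T.root := by
  classical
  simp only [ancestorsOf, Finset.mem_biUnion, mem_ancestors]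
  constructor
  · rintro ⟨w, hw, h, h'⟩
    exact ⟨⟨w, hw, h⟩, h'⟩
  · rintro ⟨⟨w, hw, h⟩, h'⟩
    exact ⟨w, hw, h, h'⟩

/-! ### The retraction of a simplex onto a tree on its vertices -/

open Classical in
variable (T) in
/-- The mass of `x` on the branch at `u`. -/
noncomputable def mass (x : α → ℝ) (u : α) : ℝ := ∑ᶠ w, if T.Anc u w then x w else 0

variable (T) in
/-- The excess of the mass on the branch at `v` over the mass outside of this branch and of the
parent of `v`. -/
noncomputable def excess (x : α → ℝ) (v : α) : ℝ := 2 * T.mass x v + x (T.parent v) - 1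

open Classical in
variable (T) in
/-- The height of the image of `x` under the retraction onto the tree. -/
noncomputable def height (x : α → ℝ) : ℝ :=
  ∑ᶠ u, if u = T.root then 0 else max 0 (T.excess x u)

open Classical in
variable (T) in
/-- The retraction of a simplex on the vertices of the tree onto the tree, followed by the
contraction of the tree that scales the height of every point by `l`. -/
noncomputable def retract (x : α → ℝ) (l : ℝ) (v : α) : ℝ :=
  if v = T.root ∨ 0 < T.excess x v then max 0 (1 - |l * T.height x - T.depth v|) else 0

variable {x : α → ℝ} {s : Finset α}

open Classical in
theorem mass_eq (hx : ∀ v, v ∉ s → x v = 0) (u : α) :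
    T.mass x u = ∑ w ∈ s, if T.Anc u w then x w else 0 :=
  finsum_eq_sum_of_support_subset _ fun w hw => by
    by_contra h
    exact hw (by simp [hx w h])

/-- The branch at `v` and the vertex `p` are disjoint parts of the branch at `u`. -/
theorem mass_add_le (hx : IsBary x s) {u v p : α} (huv : T.Anc u v) (hup : T.Anc u p)
    (hvp : ¬ T.Anc v p) : T.mass x v + x p ≤ T.mass x u := by
  classical
  rw [mass_eq hx.2.1, mass_eq hx.2.1, hx.coord_eq_sum p, ← Finset.sum_add_distrib]
  refine Finset.sum_le_sum fun w _ => ?_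
  have := hx.1 w
  by_cases hw : w = p
  · subst hw
    simp [hup, hvp]
  · by_cases h : T.Anc v w
    · simp [hw, h, huv.trans h]
    · simp only [h, hw, if_false, add_zero]
      split_ifs
      · exact this
      · rfl

theorem mass_root (hx : IsBary x s) : T.mass x T.root = 1 := by
  rw [mass_eq hx.2.1, ← hx.2.2]
  exact Finset.sum_congr rfl fun w _ => if_pos (root_anc w)

theorem mass_add_parent_le (hx : IsBary x s) (hu : u ≠ T.root) :
    T.mass x u + x (T.parent u) ≤ 1 := by
  rw [← mass_root (T := T) hx]
  exact mass_add_le hx (root_anc _) (root_anc _) (not_anc_parent hu)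

theorem excess_le_one (hx : IsBary x s) (hu : u ≠ T.root) : T.excess x u ≤ 1 := by
  have h1 := mass_add_parent_le hx hu
  have h2 := hx.1 (T.parent u)
  have h3 : T.mass x u ≤ 1 := by linarith
  rw [excess]
  linarith

/-- The branch at `u` contains the branch at `v` and, disjoint from it, the parent of `v`.
Consequently positivity of the excess passes to all ancestors other than the root. -/
theorem excess_le_of_anc (hx : IsBary x s) (h : T.Anc u v) (hne : u ≠ v) :
    T.excess x v ≤ T.excess x u := by
  have hv : v ≠ T.root := by
    rintro rfl
    exact hne h.eq_root
  have h1 := mass_add_le hx h (h.eq_or.resolve_left hne) (not_anc_parent hv)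
  have h2 := hx.1 (T.parent u)
  have h3 := hx.1 (T.parent v)
  rw [excess, excess]
  linarith

/-- For incomparable `u` and `v` the two excesses sum to at most zero: a vertex in one of the
branches is counted twice there and nowhere else, and any other vertex is counted at most once as
each parent. One of the inequalities may be weak, which is the case needed at the boundary in the
continuity proof. -/
theorem comparable_of_excess (hx : IsBary x s) (hu : u ≠ T.root) (hv : v ≠ T.root)
    (h : 0 < T.excess x u) (h' : 0 ≤ T.excess x v) : T.Anc u v ∨ T.Anc v u := by
  classical
  by_contra! hn
  have key : 2 * T.mass x u + x (T.parent u) + (2 * T.mass x v + x (T.parent v)) ≤ 2 := by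
    have : (2 : ℝ) = ∑ w ∈ s, 2 * x w := by rw [← Finset.mul_sum, hx.2.2, mul_one]
    rw [mass_eq hx.2.1, mass_eq hx.2.1, hx.coord_eq_sum (T.parent u),
      hx.coord_eq_sum (T.parent v), Finset.mul_sum, Finset.mul_sum, ← Finset.sum_add_distrib,
      ← Finset.sum_add_distrib, ← Finset.sum_add_distrib]
    refine (Finset.sum_le_sum (g := fun w => 2 * x w) fun w _ => ?_).trans_eq this.symm
    have h0 := hx.1 w
    have a1 : T.Anc u w → T.Anc v w → False := fun h1 h2 => (h1.total h2).elim hn.1 hn.2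
    have a2 : T.Anc u w → w ≠ T.parent u := fun h1 h2 => not_anc_parent hu (h2 ▸ h1)
    have a3 : T.Anc v w → w ≠ T.parent v := fun h1 h2 => not_anc_parent hv (h2 ▸ h1)
    have a4 : T.Anc u w → w ≠ T.parent v := fun h1 h2 => hn.1 ((h2 ▸ h1).trans (anc_parent v))
    have a5 : T.Anc v w → w ≠ T.parent u := fun h1 h2 => hn.2 ((h2 ▸ h1).trans (anc_parent u))
    by_cases h1 : T.Anc u w
    · have h2 : ¬ T.Anc v w := fun h2 => a1 h1 h2
      simp [h1, h2, a2 h1, a4 h1]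
    · by_cases h2 : T.Anc v w
      · simp [h1, h2, a3 h2, a5 h2]
      · simp only [h1, h2, if_false]
        split_ifs <;> linarith
  rw [excess] at h h'
  linarith

theorem mass_pos_of_excess_pos (hx : IsBary x s) (hu : u ≠ T.root) (h : 0 < T.excess x u) :
    0 < T.mass x u := by
  have h1 := mass_add_parent_le hx hu
  rw [excess] at h
  linarith

/-- This makes the sum defining the height finite, over a set that depends only on `s`. -/
theorem exists_anc_of_excess_pos (hx : IsBary x s) (hu : u ≠ T.root) (h : 0 < T.excess x u) :
    ∃ w ∈ s, T.Anc u w := by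
  classical
  by_contra! hn
  refine (mass_pos_of_excess_pos hx hu h).ne' ?_
  rw [mass_eq hx.2.1]
  exact Finset.sum_eq_zero fun w hw => if_neg (hn w hw)

theorem height_eq_of_subset {A : Finset α}
    (hA : ∀ u, u ≠ T.root → 0 < T.excess x u → u ∈ A) (hr : T.root ∉ A) :
    T.height x = ∑ u ∈ A, max 0 (T.excess x u) := by
  classical
  rw [height, finsum_eq_sum_of_support_subset (s := A)]
  · refine Finset.sum_congr rfl fun u hu => if_neg ?_
    rintro rfl
    exact hr hu
  · intro u hu
    by_cases h : u = T.root
    · simp [h] at hu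
    · refine hA u h ?_
      by_contra h'
      exact hu (by simp [h, not_lt.1 h'])

theorem height_eq (hx : IsBary x s) :
    T.height x = ∑ u ∈ T.ancestorsOf s, max 0 (T.excess x u) :=
  height_eq_of_subset
    (fun _ h h' => mem_ancestorsOf.2 ⟨exists_anc_of_excess_pos hx h h', h⟩)
    fun h => (mem_ancestorsOf.1 h).2 rfl

theorem height_nonneg (hx : IsBary x s) : 0 ≤ T.height x := by
  rw [height_eq hx]
  exact Finset.sum_nonneg fun _ _ => le_max_left _ _

/-- At most `T.depth w` vertices contribute, each of them at most one. -/
theorem height_le (hx : IsBary x s)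
    (h : ∀ u, u ≠ T.root → 0 < T.excess x u → T.Anc u w) : T.height x ≤ T.depth w := by
  rw [height_eq_of_subset (A := T.ancestors w) (fun u hu hp => mem_ancestors.2 ⟨h u hu hp, hu⟩)
    fun h => (mem_ancestors.1 h).2 rfl, ← card_ancestors]
  refine (Finset.sum_le_card_nsmul _ _ 1 fun u hu => ?_).trans (by simp)
  exact max_le zero_le_one (excess_le_one hx (mem_ancestors.1 hu).2)

/-- If the excess at `v` vanishes, every vertex of positive excess is a proper ancestor of `v`. So
the tent function at `v` is already zero where the definition of `retract` switches cases. -/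
theorem height_le_of_excess_eq_zero (hx : IsBary x s) (hv : v ≠ T.root)
    (h : T.excess x v = 0) : T.height x ≤ T.depth v - 1 := by
  have : T.height x ≤ T.depth (T.parent v) := height_le hx fun u hu hp => by
    have hne : u ≠ v := by
      rintro rfl
      exact hp.ne' h
    rcases comparable_of_excess hx hu hv hp h.ge with h' | h'
    · exact h'.eq_or.resolve_left hne
    · exact absurd (excess_le_of_anc hx h' hne.symm) (by rw [h]; exact hp.not_ge)
  rw [T.depth_eq v hv]
  simpa using this

/-- The vertices of positive excess form the path from the root to some vertex. -/
theorem exists_top (hx : IsBary x s) : ∃ w, (∃ z ∈ s, T.Anc w z) ∧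
    ∀ u, (u = T.root ∨ 0 < T.excess x u) ↔ T.Anc u w := by
  classical
  let C := insert T.root ((T.ancestorsOf s).filter fun u => 0 < T.excess x u)
  have hC : ∀ u, u ∈ C ↔ u = T.root ∨ 0 < T.excess x u := fun u => by
    simp only [C, Finset.mem_insert, Finset.mem_filter, mem_ancestorsOf]
    by_cases hu : u = T.root
    · simp [hu]
    · simp only [hu, false_or]
      exact ⟨fun h => h.2, fun h => ⟨⟨exists_anc_of_excess_pos hx hu h, hu⟩, h⟩⟩
  -- By comparability, all of `C` lies on the path from the root to a deepest element.
  obtain ⟨w, hw, hmax⟩ := C.exists_max_image T.depth ⟨_, Finset.mem_insert_self _ _⟩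
  have hne : s.Nonempty := by
    by_contra h
    have := hx.2.2
    rw [Finset.not_nonempty_iff_eq_empty.1 h] at this
    simp at this
  refine ⟨w, ?_, fun u => ⟨fun hu => ?_, fun hu => ?_⟩⟩
  · by_cases h : w = T.root
    · obtain ⟨z, hz⟩ := hne
      exact ⟨z, hz, h ▸ root_anc z⟩
    · exact exists_anc_of_excess_pos hx h (((hC w).1 hw).resolve_left h)
  · by_cases hur : u = T.root
    · exact hur ▸ root_anc w
    have hu' := hu.resolve_left hur
    by_cases hwr : w = T.root
    · have h1 := hmax u ((hC u).2 hu)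
      have h2 := T.depth_eq u hur
      rw [hwr, T.depth_root] at h1
      omega
    rcases comparable_of_excess hx hur hwr hu' (((hC w).1 hw).resolve_left hwr).le with h | h
    · exact h
    · by_cases hne : w = u
      · exact hne ▸ anc_refl _
      · exact absurd (hmax u ((hC u).2 hu)) (h.depth_lt hne).not_ge
  · by_cases hur : u = T.root
    · exact Or.inl hur
    have hwr : w ≠ T.root := by
      rintro rfl
      exact hur hu.eq_root
    have hw' := ((hC w).1 hw).resolve_left hwr
    by_cases hne : u = w
    · exact Or.inr (hne ▸ hw')
    · exact Or.inr (hw'.trans_le (excess_le_of_anc hx hu hne))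

open Classical in
/-- The point at height `y` on the path from the root to `w` lies on an edge of this path. -/
theorem exists_edge_of_height (w : α) {y : ℝ} (h0 : 0 ≤ y) (h1 : y ≤ T.depth w) :
    ∃ v, T.Anc v w ∧
      IsBary (fun u => if T.Anc u w then max 0 (1 - |y - T.depth u|) else 0)
        {v, T.parent v} := by
  induction h : T.depth w generalizing w with
  | zero =>
    have hw : w = T.root := by
      by_contra hne
      have := T.depth_eq w hne
      omega
    subst hw
    rw [h] at h1
    have hy : y = 0 := le_antisymm (by simpa using h1) h0
    refine ⟨T.root, anc_refl _, fun u => ?_, fun u hu => if_neg fun h => hu ?_, ?_⟩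
    · dsimp only
      split_ifs
      · exact le_max_left _ _
      · rfl
    · simp [h.eq_root]
    · simp [T.parent_root, anc_refl, hy, T.depth_root]
  | succ n ih =>
    have hw : w ≠ T.root := by
      rintro rfl
      rw [T.depth_root] at h
      omega
    have hd : T.depth (T.parent w) = n := by
      have := T.depth_eq w hw
      omega
    have hwn : T.parent w ≠ w := fun h =>
      not_anc_parent hw (by rw [h]; exact anc_refl _)
    rw [h] at h1
    push_cast at h1
    rcases le_total y n with hy | hy
    -- Up to height `n` the tent function at `w` vanishes, so the path to the parent suffices.
    · obtain ⟨v, hv, hb⟩ := ih (T.parent w) (by rwa [hd]) hd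
      refine ⟨v, hv.trans (anc_parent w), ?_⟩
      convert hb using 2 with u
      by_cases hu : T.Anc u (T.parent w)
      · simp [hu, hu.trans (anc_parent w)]
      · rw [if_neg hu]
        split_ifs with hu'
        · rw [hu'.eq_or.resolve_right hu, h]
          refine max_eq_left ?_
          rw [abs_of_nonpos] <;> push_cast <;> linarith
        · rfl
    · refine ⟨w, anc_refl _, fun u => ?_, fun u hu => ?_, ?_⟩
      · dsimp only
        split_ifs
        · exact le_max_left _ _
        · rfl
      · simp only [Finset.mem_insert, Finset.mem_singleton, not_or] at hu
        dsimp only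
        split_ifs with h'
        · have h3 := (h'.eq_or.resolve_left hu.1).depth_lt hu.2
          rw [hd] at h3
          have h4 : (T.depth u : ℝ) + 1 ≤ n := by exact_mod_cast h3
          refine max_eq_left ?_
          rw [abs_of_nonneg] <;> linarith
        · rfl
      · rw [Finset.sum_pair hwn.symm, if_pos (anc_refl _), if_pos (anc_parent _), h, hd,
          abs_of_nonpos, abs_of_nonneg, max_eq_right, max_eq_right] <;> push_cast <;> linarith

/-- The image lies on the edge from `v` to its parent. As `v` is an ancestor of a vertex of `s`, the
edge stays in any star that contains `s`. Allowing every `t` that contains the edge serves both for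
the edge itself and for its union with `s`. -/
theorem retract_isBary (hx : IsBary x s) {l : ℝ} (h0 : 0 ≤ l) (h1 : l ≤ 1) :
    ∃ v, (∃ z ∈ s, T.Anc v z) ∧
      ∀ t : Finset α, v ∈ t → T.parent v ∈ t → IsBary (T.retract x l) t := by
  classical
  obtain ⟨w, ⟨z, hz, hwz⟩, hw⟩ := exists_top (T := T) hx
  have hh : T.height x ≤ T.depth w := height_le hx fun u _ hp => (hw u).1 (Or.inr hp)
  have hn := height_nonneg (T := T) hx
  obtain ⟨v, hv, hb⟩ := exists_edge_of_height (T := T) w (mul_nonneg h0 hn)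
    ((mul_le_of_le_one_left hn h1).trans hh)
  refine ⟨v, ⟨z, hz, hv.trans hwz⟩, fun t h1 h2 => ?_⟩
  have : T.retract x l =
      fun u => if T.Anc u w then max 0 (1 - |l * T.height x - T.depth u|) else 0 := by
    funext u
    rw [retract]
    simp only [hw u]
  rw [this]
  refine hb.mono ?_
  intro u hu
  simp only [Finset.mem_insert, Finset.mem_singleton] at hu
  rcases hu with rfl | rfl
  · exact h1
  · exact h2

/-- The finite set containing the support depends on the face only, as the continuity criterion
requires. -/
theorem retract_eq_zero [DecidableEq α] (hx : IsBary x s) (l : ℝ) (h : v ∉ insert T.root (T.ancestorsOf s)) :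
    T.retract x l v = 0 := by
  rw [Finset.mem_insert, not_or] at h
  refine if_neg (not_or.2 ⟨h.1, fun hp => h.2 ?_⟩)
  exact mem_ancestorsOf.2 ⟨exists_anc_of_excess_pos hx h.1 hp, h.1⟩

theorem retract_zero [DecidableEq α] (x : α → ℝ) : T.retract x 0 = Pi.single T.root 1 := by
  funext v
  by_cases hv : v = T.root
  · subst hv
    simp [retract, T.depth_root]
  · rw [Pi.single_eq_of_ne hv, retract]
    have : (1 : ℝ) ≤ T.depth v := by
      rw [T.depth_eq v hv]
      push_cast
      linarith [(T.depth (T.parent v)).cast_nonneg (α := ℝ)]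
    split_ifs
    · refine max_eq_left ?_
      rw [zero_mul, zero_sub, abs_neg, Nat.abs_cast]
      linarith
    · rfl

/-- For a point of the edge from `v` to its parent, the excess is `x v` at `v`, one at the ancestors
of the parent other than the root, and not positive at other nonroot vertices. Hence the height is
the depth of the parent plus `x v`, and the tent functions give back `x`. -/
theorem retract_one (hx : IsBary x s) (h : ∀ u, u ≠ v → u ≠ T.parent v → x u = 0) :
    T.retract x 1 = x := by
  classical
  have hx : IsBary x {v, T.parent v} := hx.of_support fun u hu => by
    simp only [Finset.mem_insert, Finset.mem_singleton, not_or] at hu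
    exact h u hu.1 hu.2
  by_cases hv : v = T.root
  · subst hv
    rw [T.parent_root, Finset.pair_eq_singleton] at hx
    have h0 : ∀ u, u ≠ T.root → x u = 0 := fun u hu => hx.2.1 u (by simpa using hu)
    have h1 : x T.root = 1 := by simpa using hx.2.2
    have hh : T.height x = 0 := by
      rw [height_eq_of_subset (A := ∅) (fun u hu hp => ?_) (by simp), Finset.sum_empty]
      have hm : T.mass x u = 0 := by
        rw [mass_eq hx.2.1, Finset.sum_singleton, if_neg fun h => hu h.eq_root]
      rw [excess, hm] at hp
      linarith [hx.le_one (T.parent u)]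
    have : T.retract x 1 = T.retract x 0 := by
      funext u
      simp only [retract, hh, mul_zero]
    rw [this, retract_zero]
    funext u
    by_cases hu : u = T.root
    · rw [hu, h1, Pi.single_eq_same]
    · rw [h0 u hu, Pi.single_eq_of_ne hu]
  have hvp : v ≠ T.parent v := fun h => not_anc_parent hv (h ▸ anc_refl _)
  have hsum : x v + x (T.parent v) = 1 := by rw [← hx.2.2, Finset.sum_pair hvp]
  have hmass : ∀ u, T.mass x u =
      (if T.Anc u v then x v else 0) + if T.Anc u (T.parent v) then x (T.parent v) else 0 :=
    fun u => by rw [mass_eq hx.2.1, Finset.sum_pair hvp]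
  have hev : T.excess x v = x v := by
    rw [excess, hmass, if_pos (anc_refl _), if_neg (not_anc_parent hv)]
    linarith
  have hea : ∀ u, T.Anc u (T.parent v) → u ≠ T.root → T.excess x u = 1 := fun u hu hur => by
    have d1 := hu.depth_le
    have d2 := T.depth_eq v hv
    have d3 := T.depth_eq u hur
    have : x (T.parent u) = 0 := h _ (by intro e; rw [e] at d3; omega)
      (by intro e; rw [e] at d3; omega)
    rw [excess, hmass, if_pos (hu.trans (anc_parent v)), if_pos hu, this]
    linarith
  have heo : ∀ u, u ≠ v → ¬ T.Anc u (T.parent v) → ¬ 0 < T.excess x u := fun u hu hn => by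
    rw [excess, hmass, if_neg hn, if_neg fun h => (h.eq_or.resolve_left hu |> hn)]
    linarith [hx.le_one (T.parent u)]
  have hnot : v ∉ T.ancestors (T.parent v) := fun h => not_anc_parent hv (mem_ancestors.1 h).1
  have hh : T.height x = x v + T.depth (T.parent v) := by
    rw [height_eq_of_subset (A := insert v (T.ancestors (T.parent v))) (fun u hu hp => ?_) ?_,
      Finset.sum_insert hnot, hev, max_eq_right (hx.1 v), ← card_ancestors]
    · congr 1
      rw [Finset.sum_congr rfl fun u hu => by
        rw [hea u (mem_ancestors.1 hu).1 (mem_ancestors.1 hu).2, max_eq_right zero_le_one]]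
      simp
    · rw [Finset.mem_insert, mem_ancestors]
      rintro (h | h)
      · exact hv h.symm
      · exact h.2 rfl
    · rw [Finset.mem_insert, mem_ancestors]
      by_contra hn
      rw [not_or] at hn
      exact heo u hn.1 (fun h => hn.2 ⟨h, hu⟩) hp
  have hd : (T.depth v : ℝ) = T.depth (T.parent v) + 1 := by exact_mod_cast T.depth_eq v hv
  have hx1 := hx.le_one v
  have hx0 := hx.1 v
  funext u
  by_cases huv : u = v
  · subst huv
    rw [retract, hev, hh, hd]
    split_ifs with hc
    · rw [abs_of_nonpos, max_eq_right] <;> linarith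
    · rw [not_or, not_lt] at hc
      linarith
  by_cases hup : T.Anc u (T.parent v)
  · have hc : u = T.root ∨ 0 < T.excess x u := by
      by_cases hr : u = T.root
      · exact Or.inl hr
      · exact Or.inr (by rw [hea u hup hr]; exact zero_lt_one)
    rw [retract, if_pos hc, hh]
    by_cases he : u = T.parent v
    · rw [he, abs_of_nonneg, max_eq_right] <;> linarith
    · have h3 : (T.depth u : ℝ) + 1 ≤ T.depth (T.parent v) := by exact_mod_cast hup.depth_lt he
      rw [h u huv he, abs_of_nonneg, max_eq_left] <;> linarith
  · have hr : u ≠ T.root := by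
      rintro rfl
      exact hup (root_anc _)
    rw [retract, if_neg (not_or.2 ⟨hr, heo u huv hup⟩), h u huv]
    rintro rfl
    exact hup (anc_refl _)

theorem continuous_mass {Z : Type*} [TopologicalSpace Z] {x : Z → α → ℝ}
    (hx : ∀ z, IsBary (x z) s) (hc : ∀ v, Continuous fun z => x z v) (u : α) :
    Continuous fun z => T.mass (x z) u := by
  classical
  simp only [fun z => mass_eq (T := T) (hx z).2.1 u]
  refine continuous_finsetSum _ fun w _ => ?_
  split_ifs
  · exact hc w
  · exact continuous_const

theorem continuous_excess {Z : Type*} [TopologicalSpace Z] {x : Z → α → ℝ}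
    (hx : ∀ z, IsBary (x z) s) (hc : ∀ v, Continuous fun z => x z v) (u : α) :
    Continuous fun z => T.excess (x z) u :=
  ((continuous_const.mul (continuous_mass hx hc u)).add (hc _)).sub continuous_const

theorem continuous_height {Z : Type*} [TopologicalSpace Z] {x : Z → α → ℝ}
    (hx : ∀ z, IsBary (x z) s) (hc : ∀ v, Continuous fun z => x z v) :
    Continuous fun z => T.height (x z) := by
  simp only [fun z => height_eq (T := T) (hx z)]
  exact continuous_finsetSum _ fun u _ => continuous_const.max (continuous_excess hx hc u)

/-- The two cases of the definition agree where the excess at `v` is zero, by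
`height_le_of_excess_eq_zero`. Scaling by `l ≤ 1` only lowers the height, so the bound survives. -/
theorem continuous_retract {Z : Type*} [TopologicalSpace Z] {x : Z → α → ℝ}
    (hx : ∀ z, IsBary (x z) s) (hc : ∀ v, Continuous fun z => x z v) {l : Z → ℝ}
    (hl : Continuous l) (h1 : ∀ z, l z ≤ 1) (v : α) :
    Continuous fun z => T.retract (x z) (l z) v := by
  classical
  have hhat : Continuous fun z => max 0 (1 - |l z * T.height (x z) - T.depth v|) :=
    continuous_const.max (continuous_const.sub
      ((hl.mul (continuous_height hx hc)).sub continuous_const).abs)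
  by_cases hv : v = T.root
  · simpa only [retract, hv, true_or, if_true] using hhat
  have : ∀ z, T.retract (x z) (l z) v = if T.excess (x z) v ≤ 0 then 0
      else max 0 (1 - |l z * T.height (x z) - T.depth v|) := fun z => by
    rw [retract, ← ite_not]
    simp only [hv, false_or, not_lt]
  simp only [this]
  refine Continuous.if_le continuous_const hhat (continuous_excess hx hc v) continuous_const
    fun z hz => ?_
  have h2 := height_le_of_excess_eq_zero (hx z) hv hz
  have h3 := mul_le_of_le_one_left (height_nonneg (T := T) (hx z)) (h1 z)
  rw [abs_of_nonpos, max_eq_left] <;> linarith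

end ParentTree

/-! ### Clique complexes -/

theorem IsBary.nonempty {α : Type*} {x : α → ℝ} {s : Finset α} (hx : IsBary x s) :
    s.Nonempty := by
  by_contra h
  have := hx.2.2
  rw [Finset.not_nonempty_iff_eq_empty.1 h] at this
  simp at this

namespace SimpleGraph

/-- The geometric realization of the clique complex of a graph. -/
abbrev CliqueSpace {α : Type*} (H : SimpleGraph α) : Type _ :=
  GeometricRealization H.cliqueComplex.toPreAbstractSimplicialComplex

namespace CliqueSpace

variable {α : Type*} {H : SimpleGraph α}

theorem isBary_ofFace (s : H.cliqueComplex.toPreAbstractSimplicialComplex.faces)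
    (y : stdSimplex ℝ s.1) : IsBary (GeometricRealization.ofFace _ s y).coord s.1 :=
  ⟨GeometricRealization.nonneg _,
    fun _ hv => GeometricRealization.coord_ofFace_of_notMem s y hv,
    GeometricRealization.sum_coord_ofFace s y⟩

/-- A point of the clique complex with prescribed coordinates. -/
def mk (x : α → ℝ) (h : ∃ s, IsBary x s ∧ H.IsClique (s : Set α)) : H.CliqueSpace where
  coord := x
  nonneg := by
    obtain ⟨s, hs, -⟩ := h
    exact hs.1
  exists_face := by
    obtain ⟨s, hs, hc⟩ := h
    exact ⟨s, ⟨hs.nonempty, hc⟩, hs.2⟩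

theorem exists_clique (x : H.CliqueSpace) :
    ∃ s : Finset α, H.IsClique (s : Set α) ∧ (∀ v, v ∈ s ↔ 0 < x.coord v) ∧ IsBary x.coord s := by
  obtain ⟨s, hs, h⟩ := GeometricRealization.exists_carrier x
  have h0 : ∀ v, v ∉ s → x.coord v = 0 := fun v hv =>
    x.coord_eq_zero_of_not_pos fun h' => hv ((h v).2 h')
  exact ⟨s, hs.2, h, x.nonneg, h0, x.sum_coord_eq_one h0⟩

/-- A retraction between clique complexes of graphs on the same vertices that moves every point
within a clique is a homotopy equivalence. -/
theorem homotopyEquiv_of_retraction {H' : SimpleGraph α} (hle : H' ≤ H)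
    (r : H.CliqueSpace → H'.CliqueSpace)
    (hr : GeometricRealization.FaceContinuous fun x => (r x).coord)
    (hface : ∀ x, ∃ t : Finset α, H.IsClique (t : Set α) ∧ IsBary x.coord t ∧
      IsBary (r x).coord t)
    (hid : ∀ (x : H.CliqueSpace) (s : Finset α), H'.IsClique (s : Set α) → IsBary x.coord s →
      (r x).coord = x.coord) :
    Nonempty (ContinuousMap.HomotopyEquiv H.CliqueSpace H'.CliqueSpace) := by
  have hsub : H'.cliqueComplex.toPreAbstractSimplicialComplex.faces ⊆
      H.cliqueComplex.toPreAbstractSimplicialComplex.faces := fun s hs => ⟨hs.1, hs.2.mono hle⟩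
  refine GeometricRealization.homotopyEquiv_of_retraction hsub r hr (fun x => ?_) fun x => ?_
  · obtain ⟨t, ht, h1, h2⟩ := hface x
    exact ⟨t, ⟨h1.nonempty, ht⟩, fun v hv => ⟨h1.2.1 v hv, h2.2.1 v hv⟩⟩
  · obtain ⟨s, hs, -, hb⟩ := exists_clique x
    exact GeometricRealization.ext (hid (GeometricRealization.inclusion hsub x) s hs hb)

end CliqueSpace

end SimpleGraph

/-! ### Star systems: retracting every star onto its tree -/

/-- A cover of a set by "stars", any two of which share at most one element, with a tree on every
star. Three elements that pairwise lie in a star but not all in the same one form a triangle; the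
sides of a triangle are edges of the trees. -/
structure StarSystem (ι α : Type*) where
  /-- the stars -/
  star : ι → Set α
  /-- the trees on the stars -/
  tree : ι → ParentTree α
  root_mem : ∀ v, (tree v).root ∈ star v
  parent_mem : ∀ v, ∀ a ∈ star v, (tree v).parent a ∈ star v
  star_eq : ∀ {v w a b}, a ≠ b → a ∈ star v → b ∈ star v → a ∈ star w → b ∈ star w → v = w

namespace StarSystem

variable {ι α : Type*} (S : StarSystem ι α)

/-- Two elements are joined if they lie in a common star. -/
def lineGraph : SimpleGraph α where
  Adj a b := a ≠ b ∧ ∃ v, a ∈ S.star v ∧ b ∈ S.star v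
  symm := ⟨fun _ _ h => ⟨h.1.symm, h.2.imp fun _ h => h.symm⟩⟩
  loopless := ⟨fun _ h => h.1 rfl⟩

/-- The union of the trees on the stars. -/
def treeGraph : SimpleGraph α where
  Adj a b := a ≠ b ∧ ∃ v, a ∈ S.star v ∧ b ∈ S.star v ∧
    ((S.tree v).parent a = b ∨ (S.tree v).parent b = a)
  symm := ⟨fun _ _ h => ⟨h.1.symm, h.2.imp fun _ h => ⟨h.2.1, h.1, h.2.2.symm⟩⟩⟩
  loopless := ⟨fun _ h => h.1 rfl⟩

/-- Three elements that pairwise lie in a star, but not all in the same one. -/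
def IsTriangle (a b c : α) : Prop :=
  S.lineGraph.Adj a b ∧ S.lineGraph.Adj b c ∧ S.lineGraph.Adj a c ∧
    ¬ ∃ v, a ∈ S.star v ∧ b ∈ S.star v ∧ c ∈ S.star v

/-- The conditions on the triangles of a star system under which its clique complex is
one-dimensional up to homotopy. -/
structure Regular : Prop where
  triangle_unique : ∀ {a b c d}, S.IsTriangle a b c → S.IsTriangle a b d → c = d
  triangle_adj : ∀ {a b c}, S.IsTriangle a b c → S.treeGraph.Adj a b
  clique_cases : ∀ s : Finset α, S.lineGraph.IsClique (s : Set α) → (∃ v, ∀ a ∈ s, a ∈ S.star v) ∨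
    ∃ a b c, S.IsTriangle a b c ∧ ∀ d, d ∈ s ↔ d = a ∨ d = b ∨ d = c

variable {S}

theorem IsTriangle.swap {a b c : α} (h : S.IsTriangle a b c) : S.IsTriangle b a c :=
  ⟨h.1.symm, h.2.2.1, h.2.1, fun ⟨v, h1, h2, h3⟩ => h.2.2.2 ⟨v, h2, h1, h3⟩⟩

theorem IsTriangle.rotate {a b c : α} (h : S.IsTriangle a b c) : S.IsTriangle b c a :=
  ⟨h.2.1, h.2.2.1.symm, h.1.symm, fun ⟨v, h1, h2, h3⟩ => h.2.2.2 ⟨v, h3, h1, h2⟩⟩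

theorem Regular.isClique_of_triangle (hS : S.Regular) {a b c : α} (htri : S.IsTriangle a b c)
    {s : Finset α} (h : ∀ d, d ∈ s ↔ d = a ∨ d = b ∨ d = c) : S.treeGraph.IsClique (s : Set α) := by
  have h12 := hS.triangle_adj htri
  have h23 := hS.triangle_adj htri.rotate
  have h31 := hS.triangle_adj htri.rotate.rotate
  intro d hd e he hne
  rcases (h d).1 hd with rfl | rfl | rfl <;> rcases (h e).1 he with rfl | rfl | rfl <;>
    first | exact absurd rfl hne | assumption | (apply SimpleGraph.Adj.symm; assumption)

theorem treeGraph_le : S.treeGraph ≤ S.lineGraph := fun _ _ h =>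
  ⟨h.1, h.2.imp fun _ h => ⟨h.1, h.2.1⟩⟩

theorem anc_mem {v : ι} {a b : α} (h : (S.tree v).Anc a b) (hb : b ∈ S.star v) :
    a ∈ S.star v := by
  obtain ⟨n, rfl⟩ := h
  induction n with
  | zero => exact hb
  | succ n ih =>
    rw [Function.iterate_succ_apply']
    exact S.parent_mem v _ ih

theorem treeGraph_isClique_pair {v : ι} {a : α} (ha : a ∈ S.star v) :
    S.treeGraph.IsClique {a, (S.tree v).parent a} := by
  rw [SimpleGraph.isClique_pair]
  exact fun hne => ⟨hne, v, ha, S.parent_mem v a ha, Or.inl rfl⟩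

/-- A clique of the tree graph inside a star is contained in an edge of the tree on the star. -/
theorem exists_edge_of_isClique {v : ι} {s : Finset α} (hne : s.Nonempty)
    (hs : S.treeGraph.IsClique (s : Set α)) (hv : ∀ a ∈ s, a ∈ S.star v) :
    ∃ a ∈ s, ∀ b ∈ s, b = a ∨ b = (S.tree v).parent a := by
  obtain ⟨a, ha, hmax⟩ := s.exists_max_image (S.tree v).depth hne
  refine ⟨a, ha, fun b hb => ?_⟩
  by_contra! hn
  obtain ⟨-, w, haw, hbw, h⟩ := hs ha hb hn.1.symm
  obtain rfl := S.star_eq hn.1.symm haw hbw (hv a ha) (hv b hb)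
  have h := h.resolve_left hn.2.symm
  have hr : b ≠ (S.tree w).root := by
    rintro rfl
    rw [(S.tree w).parent_root] at h
    exact hn.1 h
  have h1 := (S.tree w).depth_eq b hr
  have h2 := hmax b hb
  rw [h] at h1
  omega

theorem retract_eq_self {v : ι} {s : Finset α} {x : α → ℝ} (hx : IsBary x s)
    (hs : S.treeGraph.IsClique (s : Set α)) (hv : ∀ a ∈ s, a ∈ S.star v) :
    (S.tree v).retract x 1 = x := by
  obtain ⟨a, -, h⟩ := exists_edge_of_isClique hx.nonempty hs hv
  exact ParentTree.retract_one hx (v := a) fun u h1 h2 =>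
    hx.2.1 u fun hu => (h u hu).elim h1 h2

variable (S) in
open Classical in
/-- The coordinates of the retraction of the clique complex that retracts the simplex on every
star onto the tree. -/
noncomputable def starRetract (x : α → ℝ) : α → ℝ :=
  if h : ∃ v, ∀ a, 0 < x a → a ∈ S.star v then (S.tree h.choose).retract x 1 else x

theorem starRetract_eq_self {s : Finset α} {x : α → ℝ} (hx : IsBary x s)
    (hs : S.treeGraph.IsClique (s : Set α)) : S.starRetract x = x := by
  classical
  rw [starRetract]
  split_ifs with h
  -- The chosen star is only known to contain the support of `x`, so `s` is cut down to the support.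
  · have : IsBary x (s.filter fun a => 0 < x a) := hx.of_support fun v hv => by
      by_contra hne
      have hp := lt_of_le_of_ne (hx.1 v) (Ne.symm hne)
      refine hv (Finset.mem_filter.2 ⟨?_, hp⟩)
      by_contra hvs
      exact hne (hx.2.1 v hvs)
    exact retract_eq_self this (hs.subset (Finset.coe_subset.2 (Finset.filter_subset _ _)))
      fun a ha => h.choose_spec a (Finset.mem_filter.1 ha).2
  · rfl

/-- The choice of the star is harmless: two different stars share at most one element, so a point
supported in both is a vertex, and every tree retraction fixes vertices. -/
theorem starRetract_of_star {s : Finset α} {x : α → ℝ} (hx : IsBary x s) {v : ι}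
    (hv : ∀ a ∈ s, a ∈ S.star v) : S.starRetract x = (S.tree v).retract x 1 := by
  have hv' : ∀ a, 0 < x a → a ∈ S.star v := fun a ha => hv a <| by
    by_contra h
    exact ha.ne' (hx.2.1 a h)
  have h : ∃ v, ∀ a, 0 < x a → a ∈ S.star v := ⟨v, hv'⟩
  rw [starRetract, dif_pos h]
  by_cases he : h.choose = v
  · rw [he]
  have hsub : ∀ a b, 0 < x a → 0 < x b → a = b := fun a b ha hb => by
    by_contra hab
    exact he (S.star_eq hab (h.choose_spec a ha) (h.choose_spec b hb) (hv' a ha) (hv' b hb))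
  obtain ⟨a, ha⟩ : ∃ a, 0 < x a := by
    by_contra! hn
    have := hx.2.2
    rw [Finset.sum_eq_zero fun a _ => le_antisymm (hn a) (hx.1 a)] at this
    exact zero_ne_one this
  have h0 : ∀ u, u ≠ a → x u = 0 := fun u hu => by
    by_contra hne
    exact hu (hsub u a (lt_of_le_of_ne (hx.1 u) (Ne.symm hne)) ha)
  rw [ParentTree.retract_one hx (v := a) fun u hu _ => h0 u hu,
    ParentTree.retract_one hx (v := a) fun u hu _ => h0 u hu]

/-- The clique `s` shows that the image lies in the smaller complex; the clique `t` contains both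
the point and its image and so allows the straight-line homotopy. -/
theorem starRetract_spec (hS : S.Regular) (x : S.lineGraph.CliqueSpace) :
    ∃ s t : Finset α, IsBary (S.starRetract x.coord) s ∧ S.treeGraph.IsClique (s : Set α) ∧
      S.lineGraph.IsClique (t : Set α) ∧ IsBary x.coord t ∧ IsBary (S.starRetract x.coord) t := by
  classical
  obtain ⟨c, hc, -, hb⟩ := x.exists_clique
  rcases hS.clique_cases c hc with ⟨v, hv⟩ | ⟨a₁, a₂, a₃, htri, h⟩
  · rw [starRetract_of_star hb hv]
    obtain ⟨a, ⟨z, hz, haz⟩, ha⟩ :=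
      ParentTree.retract_isBary (T := S.tree v) hb zero_le_one le_rfl
    have hav := anc_mem haz (hv z hz)
    refine ⟨{a, (S.tree v).parent a}, c ∪ {a, (S.tree v).parent a}, ha _ (by simp) (by simp), ?_,
      ?_, hb.mono Finset.subset_union_left, ha _ (by simp) (by simp)⟩
    · simpa using treeGraph_isClique_pair hav
    · have key : ∀ d ∈ c ∪ {a, (S.tree v).parent a}, d ∈ S.star v := fun d hd => by
        simp only [Finset.mem_union, Finset.mem_insert, Finset.mem_singleton] at hd
        rcases hd with hd | rfl | rfl
        · exact hv d hd
        · exact hav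
        · exact S.parent_mem v a hav
      exact fun d hd e he hne => ⟨hne, v, key d hd, key e he⟩
  · have hct := hS.isClique_of_triangle htri h
    rw [starRetract_eq_self hb hct]
    exact ⟨c, c, hb, hct, hc, hb, hb⟩

theorem homotopyEquiv_treeGraph (hS : S.Regular) :
    Nonempty (ContinuousMap.HomotopyEquiv S.lineGraph.CliqueSpace S.treeGraph.CliqueSpace) := by
  classical
  refine SimpleGraph.CliqueSpace.homotopyEquiv_of_retraction treeGraph_le
    (fun x => .mk (S.starRetract x.coord) ?_) (fun s => ?_) (fun x => ?_) fun x s hs hb => ?_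
  · obtain ⟨s, -, h1, h2, -⟩ := starRetract_spec hS x
    exact ⟨s, h1, h2⟩
  · have hb := SimpleGraph.CliqueSpace.isBary_ofFace s
    have hcont := GeometricRealization.continuous_coord_ofFace s
    change ∃ F : Finset α,
      (∀ y v, v ∉ F → S.starRetract (GeometricRealization.ofFace _ s y).coord v = 0) ∧
      ∀ v, Continuous fun y => S.starRetract (GeometricRealization.ofFace _ s y).coord v
    -- On a face inside a star the map is the retraction onto the tree; on a triangle it is the
    -- identity, because the sides are tree edges.
    rcases hS.clique_cases s.1 s.2.2 with ⟨v, hv⟩ | ⟨a₁, a₂, a₃, htri, h⟩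
    · refine ⟨insert (S.tree v).root ((S.tree v).ancestorsOf s.1), fun y u hu => ?_, fun u => ?_⟩
      · rw [starRetract_of_star (hb y) hv]
        exact ParentTree.retract_eq_zero (hb y) 1 hu
      · simp only [fun y => starRetract_of_star (hb y) hv]
        exact ParentTree.continuous_retract hb hcont continuous_const (fun _ => le_rfl) u
    · have hct := hS.isClique_of_triangle htri h
      simp only [fun y => starRetract_eq_self (hb y) hct]
      exact ⟨s.1, fun y u hu => (hb y).2.1 u hu, hcont⟩
  · obtain ⟨-, t, -, -, h1, h2, h3⟩ := starRetract_spec hS x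
    exact ⟨t, h1, h2, h3⟩
  · exact starRetract_eq_self hb hs

end StarSystem

/-! ### Collapsing the triangles -/

namespace StarSystem

variable {ι α : Type*} {S : StarSystem ι α}

/-- Inside one star a clique of the tree graph lies in an edge of the tree, so it cannot have three
elements. -/
theorem isTriangle_of_adj {a b c : α} (hab : S.treeGraph.Adj a b) (hbc : S.treeGraph.Adj b c)
    (hac : S.treeGraph.Adj a c) : S.IsTriangle a b c := by
  classical
  refine ⟨treeGraph_le hab, treeGraph_le hbc, treeGraph_le hac, ?_⟩
  rintro ⟨v, ha, hb, hc⟩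
  have hcl : S.treeGraph.IsClique (({a, b, c} : Finset α) : Set α) := by
    have hba := hab.symm
    have hcb := hbc.symm
    have hca := hac.symm
    intro d hd e he hne
    simp only [Finset.coe_insert, Finset.coe_singleton, Set.mem_insert_iff,
      Set.mem_singleton_iff] at hd he
    rcases hd with rfl | rfl | rfl <;> rcases he with rfl | rfl | rfl <;>
      first | exact absurd rfl hne | assumption
  obtain ⟨d, -, h⟩ := exists_edge_of_isClique ⟨a, by simp⟩ hcl (v := v) (by
    intro d hd
    simp only [Finset.mem_insert, Finset.mem_singleton] at hd
    rcases hd with rfl | rfl | rfl <;> assumption)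
  have h1 := h a (by simp)
  have h2 := h b (by simp)
  have h3 := h c (by simp)
  have n1 := hab.1
  have n2 := hbc.1
  have n3 := hac.1
  grind

variable [LinearOrder α]

variable (S) in
/-- In the triangle `a, b, c`, the side opposite to the largest vertex `c` is removed. -/
def Removed (a b c : α) : Prop := S.IsTriangle a b c ∧ a < c ∧ b < c

theorem Removed.swap {a b c : α} (h : S.Removed a b c) : S.Removed b a c :=
  ⟨h.1.swap, h.2.2, h.2.1⟩

variable (S) in
/-- The tree graph with one side of every triangle removed. -/
def collapsedGraph : SimpleGraph α where
  Adj a b := S.treeGraph.Adj a b ∧ ¬ ∃ c, S.Removed a b c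
  symm := ⟨fun _ _ h => ⟨h.1.symm, fun ⟨c, hc⟩ => h.2 ⟨c, hc.swap⟩⟩⟩
  loopless := ⟨fun _ h => h.1.1 rfl⟩

theorem collapsedGraph_le : S.collapsedGraph ≤ S.treeGraph := fun _ _ h => h.1

/-- Such a triple is a triangle of the star system, and the side opposite to its largest vertex has
been removed. -/
theorem collapsedGraph_not_triangle {a b c : α} (hab : S.collapsedGraph.Adj a b)
    (hbc : S.collapsedGraph.Adj b c) (hac : S.collapsedGraph.Adj a c) : False := by
  have h := isTriangle_of_adj hab.1 hbc.1 hac.1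
  have n1 := hab.1.1
  have n2 := hbc.1.1
  have n3 := hac.1.1
  rcases lt_or_gt_of_ne n1 with h1 | h1
  · rcases lt_or_gt_of_ne n2 with h2 | h2
    · exact hab.2 ⟨c, h, h1.trans h2, h2⟩
    · exact hac.2 ⟨b, h.rotate.swap.rotate.rotate, h1, h2⟩
  · rcases lt_or_gt_of_ne n3 with h2 | h2
    · exact hab.2 ⟨c, h, h2, h1.trans h2⟩
    · exact hbc.2 ⟨a, h.rotate, h1, h2⟩

/-- The side `b, c` lies in no other triangle, so its removal would need `a` to be larger than `c`.
-/
theorem Removed.collapsed_right (hS : S.Regular) {a b c : α} (h : S.Removed a b c) :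
    S.collapsedGraph.Adj b c := by
  refine ⟨hS.triangle_adj h.1.rotate, ?_⟩
  rintro ⟨d, hd⟩
  obtain rfl := hS.triangle_unique hd.1 h.1.rotate
  exact lt_asymm hd.2.2 h.2.1

theorem Removed.collapsed_left (hS : S.Regular) {a b c : α} (h : S.Removed a b c) :
    S.collapsedGraph.Adj a c :=
  h.swap.collapsed_right hS

/-- A further element would form a second triangle on the side `a, b`. -/
theorem eq_or_of_isClique_of_removed (hS : S.Regular) {s : Set α} (hs : S.treeGraph.IsClique s)
    {a b c : α} (h : S.Removed a b c) (ha : a ∈ s) (hb : b ∈ s) {d : α} (hd : d ∈ s) :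
    d = a ∨ d = b ∨ d = c := by
  by_contra! hn
  have hab := hS.triangle_adj h.1
  exact hn.2.2 (hS.triangle_unique
    (isTriangle_of_adj hab (hs hb hd hn.2.1.symm) (hs ha hd hn.1.symm)) h.1)

/-- A clique lies in the triangle of its removed side, and the other two sides of that triangle are
not removed. This makes the choice in `collapse` harmless up to `push_swap`. -/
theorem removed_unique (hS : S.Regular) {s : Set α} (hs : S.treeGraph.IsClique s)
    {a b c a' b' c' : α} (h : S.Removed a b c) (ha : a ∈ s) (hb : b ∈ s)
    (h' : S.Removed a' b' c') (ha' : a' ∈ s) (hb' : b' ∈ s) :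
    c' = c ∧ (a' = a ∧ b' = b ∨ a' = b ∧ b' = a) := by
  have k1 := eq_or_of_isClique_of_removed hS hs h ha hb ha'
  have k2 := eq_or_of_isClique_of_removed hS hs h ha hb hb'
  have hne : a' ≠ b' := h'.1.1.1
  have hbc := h.collapsed_right hS
  have hac := h.collapsed_left hS
  rcases k1 with rfl | rfl | rfl <;> rcases k2 with rfl | rfl | rfl
  · exact absurd rfl hne
  · exact ⟨hS.triangle_unique h'.1 h.1, Or.inl ⟨rfl, rfl⟩⟩
  · exact absurd ⟨_, h'⟩ hac.2
  · exact ⟨hS.triangle_unique h'.1 h.swap.1, Or.inr ⟨rfl, rfl⟩⟩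
  · exact absurd rfl hne
  · exact absurd ⟨_, h'⟩ hbc.2
  · exact absurd ⟨_, h'.swap⟩ hac.2
  · exact absurd ⟨_, h'.swap⟩ hbc.2
  · exact absurd rfl hne

/-- Push the common mass of `a` and `b` to `c`. -/
noncomputable def push (a b c : α) (x : α → ℝ) (u : α) : ℝ :=
  x u - (if u = a then min (x a) (x b) else 0) - (if u = b then min (x a) (x b) else 0) +
    if u = c then 2 * min (x a) (x b) else 0

theorem push_swap (a b c : α) (x : α → ℝ) : push a b c x = push b a c x := by
  funext u
  rw [push, push, min_comm]
  ring

theorem push_eq_self {a b c : α} {x : α → ℝ} (h : min (x a) (x b) = 0) : push a b c x = x := by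
  funext u
  simp [push, h]

/-- The smaller of the two masses drops to zero, which puts the image on a side that is kept; the
factor two at `c` preserves the total mass. -/
theorem push_isBary_of_le {a b c : α} {x : α → ℝ} (hab : a ≠ b) (hbc : b ≠ c) (hac : a ≠ c)
    (hx : IsBary x {a, b, c}) (hle : x a ≤ x b) : IsBary (push a b c x) {b, c} := by
  have h1 : push a b c x a = 0 := by simp [push, hab, hac, hle]
  have h2 : push a b c x b = x b - x a := by simp [push, hab.symm, hbc, hle]
  have h3 : push a b c x c = x c + 2 * x a := by simp [push, hac.symm, hbc.symm, hle]
  have h4 : ∀ u, u ≠ a → u ≠ b → u ≠ c → push a b c x u = 0 := fun u ha hb hc => by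
    simp [push, ha, hb, hc, hx.2.1 u (by simp [ha, hb, hc])]
  have hsum := hx.2.2
  rw [Finset.sum_insert (by simp [hab, hac]), Finset.sum_pair hbc] at hsum
  refine ⟨fun u => ?_, fun u hu => ?_, ?_⟩
  · by_cases ha : u = a
    · rw [ha, h1]
    by_cases hb : u = b
    · rw [hb, h2]
      linarith
    by_cases hc : u = c
    · rw [hc, h3]
      linarith [hx.1 a, hx.1 c]
    · rw [h4 u ha hb hc]
  · simp only [Finset.mem_insert, Finset.mem_singleton, not_or] at hu
    by_cases ha : u = a
    · rw [ha, h1]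
    · exact h4 u ha hu.1 hu.2
  · rw [Finset.sum_pair hbc, h2, h3]
    linarith

variable (S) in
open Classical in
/-- The coordinates of the map that collapses every triangle from its removed side. -/
noncomputable def collapse (x : α → ℝ) : α → ℝ :=
  if h : ∃ p : α × α × α, S.Removed p.1 p.2.1 p.2.2 ∧ 0 < x p.1 ∧ 0 < x p.2.1 then
    push h.choose.1 h.choose.2.1 h.choose.2.2 x else x

theorem collapse_of_removed (hS : S.Regular) {s : Finset α} {x : α → ℝ} (hx : IsBary x s)
    (hs : S.treeGraph.IsClique (s : Set α)) {a b c : α} (h : S.Removed a b c) (ha : a ∈ s)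
    (hb : b ∈ s) : S.collapse x = push a b c x := by
  rw [collapse]
  split_ifs with hp
  · obtain ⟨h1, h2, h3⟩ := hp.choose_spec
    obtain ⟨e, ⟨e1, e2⟩ | ⟨e1, e2⟩⟩ :=
      removed_unique hS hs h ha hb h1 (hx.mem_of_pos h2) (hx.mem_of_pos h3)
    · rw [e, e1, e2]
    · rw [e, e1, e2, push_swap]
  -- One of the two masses is zero here, so the push moves nothing.
  · refine (push_eq_self ?_).symm
    by_contra hne
    have := lt_of_le_of_ne (le_min (hx.1 a) (hx.1 b)) (Ne.symm hne)
    exact hp ⟨(a, b, c), h, lt_min_iff.1 this⟩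

theorem collapse_eq_self {s : Finset α} {x : α → ℝ} (hx : IsBary x s)
    (h : ∀ a b c, S.Removed a b c → a ∈ s → b ∈ s → False) : S.collapse x = x :=
  dif_neg fun ⟨_, h1, h2, h3⟩ => h _ _ _ h1 (hx.mem_of_pos h2) (hx.mem_of_pos h3)

theorem collapse_spec (hS : S.Regular) (x : S.treeGraph.CliqueSpace) :
    ∃ s t : Finset α, IsBary (S.collapse x.coord) s ∧ S.collapsedGraph.IsClique (s : Set α) ∧
      S.treeGraph.IsClique (t : Set α) ∧ IsBary x.coord t ∧ IsBary (S.collapse x.coord) t := by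
  obtain ⟨s, hs, -, hb⟩ := x.exists_clique
  by_cases h : ∃ a b c, S.Removed a b c ∧ a ∈ s ∧ b ∈ s
  · obtain ⟨a, b, c, h, ha, hb'⟩ := h
    rw [collapse_of_removed hS hb hs h ha hb']
    have hbc := h.collapsed_right hS
    have hac := h.collapsed_left hS
    have hab := hS.triangle_adj h.1
    have hx : IsBary x.coord {a, b, c} := hb.mono fun d hd => by
      simpa using eq_or_of_isClique_of_removed hS hs h ha hb' (d := d) hd
    have hcl : S.treeGraph.IsClique (({a, b, c} : Finset α) : Set α) :=
      hS.isClique_of_triangle h.1 fun d => by simp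
    rcases le_total (x.coord a) (x.coord b) with hle | hle
    · have key := push_isBary_of_le hab.1 hbc.1.1 hac.1.1 hx hle
      refine ⟨{b, c}, {a, b, c}, key, ?_, hcl, hx, key.mono (by simp)⟩
      rw [Finset.coe_pair, SimpleGraph.isClique_pair]
      exact fun _ => hbc
    · have hx' : IsBary x.coord {b, a, c} := by rwa [Finset.insert_comm]
      have key := push_isBary_of_le hab.1.symm hac.1.1 hbc.1.1 hx' hle
      rw [push_swap]
      refine ⟨{a, c}, {a, b, c}, key, ?_, hcl, hx, key.mono ?_⟩
      · rw [Finset.coe_pair, SimpleGraph.isClique_pair]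
        exact fun _ => hac
      · rw [Finset.insert_comm]
        simp
  · push Not at h
    rw [collapse_eq_self hb fun a b c h1 h2 h3 => h a b c h1 h2 h3]
    exact ⟨s, s, hb, fun a ha b hb hne => ⟨hs ha hb hne, fun ⟨c, hc⟩ => h a b c hc ha hb⟩,
      hs, hb, hb⟩

theorem homotopyEquiv_collapsedGraph (hS : S.Regular) : Nonempty
    (ContinuousMap.HomotopyEquiv S.treeGraph.CliqueSpace S.collapsedGraph.CliqueSpace) := by
  refine SimpleGraph.CliqueSpace.homotopyEquiv_of_retraction collapsedGraph_le
    (fun x => .mk (S.collapse x.coord) ?_) (fun s => ?_) (fun x => ?_) fun x s hs hb => ?_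
  · obtain ⟨s, -, h1, h2, -⟩ := collapse_spec hS x
    exact ⟨s, h1, h2⟩
  · have hb := SimpleGraph.CliqueSpace.isBary_ofFace s
    have hcont := GeometricRealization.continuous_coord_ofFace s
    change ∃ F : Finset α,
      (∀ y v, v ∉ F → S.collapse (GeometricRealization.ofFace _ s y).coord v = 0) ∧
      ∀ v, Continuous fun y => S.collapse (GeometricRealization.ofFace _ s y).coord v
    by_cases h : ∃ a b c, S.Removed a b c ∧ a ∈ s.1 ∧ b ∈ s.1
    · obtain ⟨a, b, c, h, ha, hb'⟩ := h
      simp only [fun y => collapse_of_removed hS (hb y) s.2.2 h ha hb']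
      -- The face may consist of the removed side alone, so `c` has to be added to the support.
      refine ⟨insert c s.1, fun y u hu => ?_, fun u => ?_⟩
      · rw [Finset.mem_insert, not_or] at hu
        have h1 : u ≠ a := by
          rintro rfl
          exact hu.2 ha
        have h2 : u ≠ b := by
          rintro rfl
          exact hu.2 hb'
        simp [push, h1, h2, hu.1, (hb y).2.1 u hu.2]
      · have hm := (hcont a).min (hcont b)
        refine (((hcont u).sub ?_).sub ?_).add ?_ <;> split_ifs <;>
          first | exact continuous_const | exact hm | exact continuous_const.mul hm
    · push Not at h
      simp only [fun y => collapse_eq_self (hb y) fun a b c h1 h2 h3 => h a b c h1 h2 h3]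
      exact ⟨s.1, fun y u hu => (hb y).2.1 u hu, hcont⟩
  · obtain ⟨-, t, -, -, h1, h2, h3⟩ := collapse_spec hS x
    exact ⟨t, h1, h2, h3⟩
  · exact collapse_eq_self hb fun a b c h ha hb' => (hs ha hb' h.1.1.1).2 ⟨c, h⟩

/-- Climb the tree towards the root; a removed tree edge is replaced by the detour over the other
two sides of its triangle. -/
theorem reachable_root {v : ι} (hS : S.Regular) {a : α} (ha : a ∈ S.star v) :
    S.collapsedGraph.Reachable a (S.tree v).root := by
  induction h : (S.tree v).depth a using Nat.strong_induction_on generalizing a with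
  | _ n ih =>
    by_cases hr : a = (S.tree v).root
    · rw [hr]
    have hd := (S.tree v).depth_eq a hr
    refine SimpleGraph.Reachable.trans ?_
      (ih _ (by omega) (S.parent_mem v a ha) rfl)
    have hne : a ≠ (S.tree v).parent a := by
      intro e
      rw [← e] at hd
      omega
    have hadj : S.treeGraph.Adj a ((S.tree v).parent a) :=
      ⟨hne, v, ha, S.parent_mem v a ha, Or.inl rfl⟩
    by_cases hrem : ∃ c, S.Removed a ((S.tree v).parent a) c
    · obtain ⟨c, hc⟩ := hrem
      exact (hc.collapsed_left hS).reachable.trans (hc.collapsed_right hS).symm.reachable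
    · exact SimpleGraph.Adj.reachable ⟨hadj, hrem⟩

theorem collapsedGraph_connected (hS : S.Regular) (h : S.lineGraph.Connected) :
    S.collapsedGraph.Connected := by
  have := h.nonempty
  refine ⟨fun a b => ?_⟩
  obtain ⟨p⟩ := h.preconnected a b
  induction p with
  | nil => rfl
  | cons hadj _ ih =>
    obtain ⟨-, v, h1, h2⟩ := hadj
    exact ((reachable_root hS h1).trans (reachable_root hS h2).symm).trans ih

end StarSystem

/-! ### The wedge of circles as a quotient of intervals -/

namespace WedgeOfCircles

variable {κ : Type*}

/-- The base point of the wedge. -/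
def base (κ : Type*) : WedgeOfCircles κ := Quot.mk _ (Sum.inl ())

/-- The `p`-th circle of the wedge. -/
def circle (p : κ) (z : Circle) : WedgeOfCircles κ := Quot.mk _ (Sum.inr ⟨p, z⟩)

theorem continuous_circle (p : κ) : Continuous (circle p) :=
  continuous_quot_mk.comp (continuous_inr.comp continuous_sigmaMk)

theorem circle_one (p : κ) : circle p 1 = base κ := Quot.sound (WedgeRel.base p)

open Classical in
/-- The position of a point of the wedge different from the base point. -/
noncomputable def position (w : WedgeOfCircles κ) : Option (κ × Circle) :=
  Quot.lift (Sum.elim (fun _ => none) fun q => if q.2 = 1 then none else some (q.1, q.2))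
    (by rintro _ _ ⟨i⟩; simp) w

theorem position_base : position (base κ) = none := rfl

theorem position_circle {p : κ} {z : Circle} (hz : z ≠ 1) :
    position (circle p z) = some (p, z) := if_neg hz

/-- The parametrization of the circles of a wedge by intervals. -/
noncomputable def ofInterval (κ : Type*) : Unit ⊕ (Σ _ : κ, I) → WedgeOfCircles κ :=
  Sum.elim (fun _ => base κ) fun q => circle q.1 (Circle.exp (2 * Real.pi * q.2))

/-- A continuous surjection from a compact space to a Hausdorff space is closed, hence a quotient
map. -/
theorem isQuotientMap_exp :
    IsQuotientMap fun t : I => Circle.exp (2 * Real.pi * t) := by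
  have hc : Continuous fun t : I => Circle.exp (2 * Real.pi * t) :=
    Circle.exp.continuous.comp (continuous_const.mul continuous_subtype_val)
  refine hc.isClosedMap.isQuotientMap hc fun z => ?_
  obtain ⟨θ, hθ⟩ := Circle.exp_surjective z
  have hpi := Real.two_pi_pos
  refine ⟨⟨Int.fract (θ / (2 * Real.pi)), Int.fract_nonneg _, (Int.fract_lt_one _).le⟩, ?_⟩
  rw [← hθ, Circle.exp_eq_exp]
  refine ⟨-⌊θ / (2 * Real.pi)⌋, ?_⟩
  simp only [Int.fract]
  push_cast
  field_simp
  ring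

theorem isQuotientMap_ofInterval : IsQuotientMap (ofInterval κ) := by
  let e : Unit ⊕ (Σ _ : κ, I) → Unit ⊕ (Σ _ : κ, Circle) :=
    Sum.map id (Sigma.map id fun _ t => Circle.exp (2 * Real.pi * t))
  have he : IsQuotientMap e := by
    refine ⟨isCoinducing_iff.2 fun U => ?_, ?_⟩
    · rw [isOpen_sum_iff, isOpen_sum_iff, isOpen_sigma_iff, isOpen_sigma_iff]
      refine and_congr Iff.rfl (forall_congr' fun p => ?_)
      exact isQuotientMap_exp.isOpen_preimage (s := {z | Sum.inr (⟨p, z⟩ : Σ _ : κ, Circle) ∈ U})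
    · rintro (x | ⟨p, z⟩)
      · exact ⟨Sum.inl x, rfl⟩
      · obtain ⟨t, rfl⟩ := isQuotientMap_exp.surjective z
        exact ⟨Sum.inr ⟨p, t⟩, rfl⟩
  have : ofInterval κ = Quot.mk (WedgeRel κ) ∘ e := by
    funext q
    rcases q with q | ⟨p, t⟩ <;> rfl
  rw [this]
  exact isQuotientMap_quot_mk.comp he

end WedgeOfCircles

/-! ### Spanning trees from distances -/

namespace ParentTree

/-- A parent is a neighbour closer to `r`. In an acyclic graph there is only one such neighbour, and
adjacent vertices have different distances to `r`, so every edge joins a vertex to its parent. -/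
theorem exists_of_connected {α : Type*} {H : SimpleGraph α} (h : H.Connected) (r : α) :
    ∃ T : ParentTree α, T.root = r ∧ (∀ v, v ≠ r → H.Adj v (T.parent v)) ∧
      (H.IsAcyclic → ∀ a b, H.Adj a b → T.parent a = b ∨ T.parent b = a) := by
  classical
  have key : ∀ v, v ≠ r → ∃ w, H.Adj v w ∧ H.dist v r = H.dist w r + 1 := fun v hv => by
    obtain ⟨p, hp⟩ := h.exists_walk_length_eq_dist v r
    cases p with
    | nil => exact absurd rfl hv
    | @cons _ w _ hadj q =>
      refine ⟨w, hadj, le_antisymm ?_ ?_⟩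
      · have := h.dist_triangle (u := v) (v := w) (w := r)
        rw [SimpleGraph.dist_eq_one_iff_adj.2 hadj] at this
        omega
      · rw [← hp, SimpleGraph.Walk.length_cons]
        exact Nat.succ_le_succ (SimpleGraph.dist_le q)
  choose! par hadj hdist using key
  let T : ParentTree α :=
    { root := r
      parent := fun v => if v = r then r else par v
      depth := fun v => H.dist v r
      parent_root := if_pos rfl
      depth_root := SimpleGraph.dist_self
      depth_eq := fun v hv => by rw [if_neg hv]; exact hdist v hv }
  have hpar : ∀ v, v ≠ r → T.parent v = par v := fun v hv => if_neg hv
  refine ⟨T, rfl, fun v hv => ?_, fun hac => ?_⟩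
  · rw [hpar v hv]
    exact hadj v hv
  · have main : ∀ a b, H.Adj a b → H.dist a r = H.dist b r + 1 → T.parent a = b := by
      intro a b hab hd
      have ha : a ≠ r := by
        rintro rfl
        rw [SimpleGraph.dist_self] at hd
        omega
      rw [hpar a ha]
      obtain ⟨p, hp⟩ := h.exists_walk_length_eq_dist b r
      obtain ⟨q, hq⟩ := h.exists_walk_length_eq_dist (par a) r
      have hp' : (SimpleGraph.Walk.cons hab p).IsPath :=
        SimpleGraph.Walk.isPath_of_length_eq_dist _ (by
          rw [SimpleGraph.Walk.length_cons, hp, hd])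
      have hq' : (SimpleGraph.Walk.cons (hadj a ha) q).IsPath :=
        SimpleGraph.Walk.isPath_of_length_eq_dist _ (by
          rw [SimpleGraph.Walk.length_cons, hq, hdist a ha])
      -- Both shortest walks from `a` to `r` are paths, hence equal, and so are their second
      -- vertices.
      have := congrArg (fun w => w.1.snd) ((hac.subsingleton_path _ _).elim ⟨_, hq'⟩ ⟨_, hp'⟩)
      simpa using this
    intro a b hab
    have h1 := h.dist_triangle (u := a) (v := b) (w := r)
    have h2 := h.dist_triangle (u := b) (v := a) (w := r)
    rw [SimpleGraph.dist_eq_one_iff_adj.2 hab] at h1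
    rw [SimpleGraph.dist_eq_one_iff_adj.2 hab.symm] at h2
    have h3 := (⟨h, hac⟩ : H.IsTree).dist_ne_of_adj r hab
    rw [SimpleGraph.dist_comm, SimpleGraph.dist_comm (u := r)] at h3
    rcases lt_or_gt_of_ne h3 with h4 | h4
    · exact Or.inr (main b a hab.symm (by omega))
    · exact Or.inl (main a b hab (by omega))

end ParentTree

/-! ### The collapse of a spanning tree and its contraction -/

namespace ParentTree

variable {α : Type*} [LinearOrder α] (T : ParentTree α) (H : SimpleGraph α)

/-- The edges of the graph that are not edges of the tree. -/
abbrev CoEdge : Type _ :=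
  {p : α × α // H.Adj p.1 p.2 ∧ p.1 < p.2 ∧ T.parent p.1 ≠ p.2 ∧ T.parent p.2 ≠ p.1}

/-- The set `s` is contained in an edge of the tree. -/
def InTree (s : Finset α) : Prop := ∃ a, ∀ u ∈ s, u = a ∨ u = T.parent a

variable {T H}

/-- The endpoints of an edge outside of the tree. -/
def CoEdge.ends (p : T.CoEdge H) : Finset α := {p.1.1, p.1.2}

theorem CoEdge.ne (p : T.CoEdge H) : p.1.1 ≠ p.1.2 := p.2.2.1.ne

theorem CoEdge.isClique (p : T.CoEdge H) : H.IsClique (p.ends : Set α) := by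
  rw [CoEdge.ends, Finset.coe_pair, SimpleGraph.isClique_pair]
  exact fun _ => p.2.1

theorem CoEdge.not_inTree (p : T.CoEdge H) {s : Finset α} (hs : T.InTree s) (h1 : p.1.1 ∈ s)
    (h2 : p.1.2 ∈ s) : False := by
  obtain ⟨a, ha⟩ := hs
  obtain ⟨-, hlt, n1, n2⟩ := p.2
  rcases ha _ h1 with e1 | e1 <;> rcases ha _ h2 with e2 | e2
  · exact hlt.ne (e1.trans e2.symm)
  · exact n1 (by rw [e1, e2])
  · exact n2 (by rw [e1, e2])
  · exact hlt.ne (e1.trans e2.symm)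

theorem CoEdge.eq_of_mem (p q : T.CoEdge H) (h1 : q.1.1 ∈ p.ends) (h2 : q.1.2 ∈ p.ends) :
    q = p := by
  simp only [CoEdge.ends, Finset.mem_insert, Finset.mem_singleton] at h1 h2
  have hp := p.2.2.1
  have hq := q.2.2.1
  apply Subtype.ext
  apply Prod.ext
  · rcases h1 with h1 | h1 <;> rcases h2 with h2 | h2 <;> rw [h1, h2] at hq
    · exact absurd hq (lt_irrefl _)
    · exact h1
    · exact absurd hq hp.not_gt
    · exact absurd hq (lt_irrefl _)
  · rcases h1 with h1 | h1 <;> rcases h2 with h2 | h2 <;> rw [h1, h2] at hq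
    · exact absurd hq (lt_irrefl _)
    · exact h2
    · exact absurd hq hp.not_gt
    · exact absurd hq (lt_irrefl _)

theorem CoEdge.sum_ends (p : T.CoEdge H) {x : α → ℝ} (hx : IsBary x p.ends) :
    x p.1.1 + x p.1.2 = 1 := by
  rw [← hx.2.2, CoEdge.ends, Finset.sum_pair p.ne]

theorem CoEdge.eq_zero (p : T.CoEdge H) {x : α → ℝ} (hx : IsBary x p.ends) {u : α}
    (h1 : u ≠ p.1.1) (h2 : u ≠ p.1.2) : x u = 0 :=
  hx.2.1 u (by simp [CoEdge.ends, h1, h2])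

/-- In a triangle-free graph every clique is in the tree or an edge outside of the tree. -/
theorem inTree_or_coEdge (hH : ∀ a b c, H.Adj a b → H.Adj b c → H.Adj a c → False)
    {s : Finset α} (hne : s.Nonempty) (hs : H.IsClique (s : Set α)) :
    T.InTree s ∨ ∃ p : T.CoEdge H, s = p.ends := by
  obtain ⟨a, ha⟩ := hne
  by_cases h : ∃ b ∈ s, b ≠ a
  · obtain ⟨b, hb, hba⟩ := h
    have hall : ∀ u ∈ s, u = a ∨ u = b := fun u hu => by
      by_contra! hn
      exact hH a b u (hs ha hb hba.symm) (hs hb hu hn.2.symm) (hs ha hu hn.1.symm)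
    by_cases h1 : T.parent a = b
    · exact Or.inl ⟨a, fun u hu => by rw [h1]; exact hall u hu⟩
    by_cases h2 : T.parent b = a
    · exact Or.inl ⟨b, fun u hu => by rw [h2]; exact (hall u hu).symm⟩
    right
    rcases lt_or_gt_of_ne hba with hlt | hlt
    · refine ⟨⟨(b, a), hs hb ha hba, hlt, h2, h1⟩, ?_⟩
      ext u
      simp only [CoEdge.ends, Finset.mem_insert, Finset.mem_singleton]
      exact ⟨fun hu => (hall u hu).symm, by rintro (rfl | rfl) <;> assumption⟩
    · refine ⟨⟨(a, b), hs ha hb hba.symm, hlt, h1, h2⟩, ?_⟩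
      ext u
      simp only [CoEdge.ends, Finset.mem_insert, Finset.mem_singleton]
      exact ⟨hall u, by rintro (rfl | rfl) <;> assumption⟩
  · push Not at h
    exact Or.inl ⟨a, fun u hu => Or.inl (h u hu)⟩

variable (T H) in
open Classical in
/-- The map from the graph to the wedge of circles that collapses the tree. -/
noncomputable def toWedge (x : α → ℝ) : WedgeOfCircles (T.CoEdge H) :=
  if h : ∃ p : T.CoEdge H, 0 < x p.1.1 ∧ 0 < x p.1.2 then
    WedgeOfCircles.circle h.choose (Circle.exp (2 * Real.pi * x h.choose.1.2))
  else WedgeOfCircles.base _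

theorem toWedge_of_inTree {s : Finset α} {x : α → ℝ} (hx : IsBary x s) (hs : T.InTree s) :
    T.toWedge H x = WedgeOfCircles.base _ :=
  dif_neg fun ⟨p, h1, h2⟩ => p.not_inTree hs (hx.mem_of_pos h1) (hx.mem_of_pos h2)

theorem exp_two_pi_mul_ne_one {t : ℝ} (h0 : 0 < t) (h1 : t < 1) :
    Circle.exp (2 * Real.pi * t) ≠ 1 := fun h => by
  rw [← Circle.exp_zero, Circle.exp_eq_exp] at h
  obtain ⟨m, hm⟩ := h
  have hpi := Real.two_pi_pos
  have : t = m := by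
    have : 2 * Real.pi * t = 2 * Real.pi * m := by linarith
    exact mul_left_cancel₀ hpi.ne' this
  rw [this] at h0 h1
  have h2 : (0 : ℤ) < m := by exact_mod_cast h0
  have h3 : m < (1 : ℤ) := by exact_mod_cast h1
  omega

theorem exp_two_pi_mul_inj {t t' : ℝ} (h0 : 0 < t) (h1 : t < 1) (h0' : 0 < t') (h1' : t' < 1)
    (h : Circle.exp (2 * Real.pi * t) = Circle.exp (2 * Real.pi * t')) : t = t' := by
  rw [Circle.exp_eq_exp] at h
  obtain ⟨m, hm⟩ := h
  have hpi := Real.two_pi_pos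
  have ht : t = t' + m := by
    have : 2 * Real.pi * t = 2 * Real.pi * (t' + m) := by linarith
    exact mul_left_cancel₀ hpi.ne' this
  have h2 : (-1 : ℤ) < m := by
    have : (-1 : ℝ) < m := by linarith
    exact_mod_cast this
  have h3 : m < (1 : ℤ) := by
    have : (m : ℝ) < 1 := by linarith
    exact_mod_cast this
  have : m = 0 := by omega
  rw [ht, this, Int.cast_zero, add_zero]

/-- The formula also holds at the endpoints of the edge, where `toWedge` takes the base point: the
parameter is then zero or one and the exponential is `1`. -/
theorem toWedge_of_coEdge (p : T.CoEdge H) {x : α → ℝ} (hx : IsBary x p.ends) :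
    T.toWedge H x = WedgeOfCircles.circle p (Circle.exp (2 * Real.pi * x p.1.2)) := by
  rw [toWedge]
  split_ifs with h
  · have := p.eq_of_mem h.choose (hx.mem_of_pos h.choose_spec.1) (hx.mem_of_pos h.choose_spec.2)
    rw [this]
  · have hsum := p.sum_ends hx
    rw [← WedgeOfCircles.circle_one p]
    congr 1
    by_cases h1 : 0 < x p.1.1
    · have h2 : x p.1.2 = 0 := le_antisymm (not_lt.1 fun h2 => h ⟨p, h1, h2⟩) (hx.1 _)
      rw [h2, mul_zero, Circle.exp_zero]
    · have h2 : x p.1.1 = 0 := le_antisymm (not_lt.1 h1) (hx.1 _)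
      have h3 : x p.1.2 = 1 := by linarith
      rw [h3, mul_one, Circle.exp_two_pi]

/-- The position on the interval after time `s`, on the middle part of the track of an edge. -/
noncomputable def middle (t s : ℝ) : ℝ := max 0 (min 1 ((3 * t - s) / (3 - 2 * s)))

open Classical in
/-- The track of the point `t` of an edge outside of the tree at time `s`: the edge is
prolonged on both sides by paths in the tree towards the root. -/
noncomputable def track (p : T.CoEdge H) (t s : ℝ) (u : α) : ℝ :=
  T.retract (Pi.single p.1.1 1) (min 1 (1 - s + 3 * t)) u +
    T.retract (Pi.single p.1.2 1) (min 1 (1 - s + 3 * (1 - t))) u -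
    (if u = p.1.1 then middle t s else 0) - (if u = p.1.2 then 1 - middle t s else 0)

open Classical in
theorem retract_single (a : α) : T.retract (Pi.single a 1) 1 = Pi.single a 1 :=
  retract_one (IsBary.single a) (v := a) fun _ hu _ => Pi.single_eq_of_ne hu _

-- At time `s` the parameters up to `s / 3` run along the tree path that ends in the first endpoint,
-- starting at the fraction `1 - s` of its height. The middle interval covers the edge itself, and
-- the last `s / 3` descends from the second endpoint. The two subtracted terms in `track` cancel
-- the endpoint masses that are counted too often.
open Classical in
theorem track_left (p : T.CoEdge H) {t s : ℝ} (h : 3 * t ≤ s) (hs : s ≤ 1) :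
    track p t s = T.retract (Pi.single p.1.1 1) (1 - s + 3 * t) := by
  funext u
  have h1 : min 1 (1 - s + 3 * t) = 1 - s + 3 * t := min_eq_right (by linarith)
  have h2 : min 1 (1 - s + 3 * (1 - t)) = 1 := min_eq_left (by linarith)
  have h3 : middle t s = 0 := by
    refine max_eq_left ((min_le_right _ _).trans ?_)
    exact div_nonpos_of_nonpos_of_nonneg (by linarith) (by linarith)
  rw [track, h1, h2, h3, retract_single, Pi.single_apply]
  split_ifs <;> ring

open Classical in
theorem track_right (p : T.CoEdge H) {t s : ℝ} (h : 3 * (1 - t) ≤ s) (hs : s ≤ 1) :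
    track p t s = T.retract (Pi.single p.1.2 1) (1 - s + 3 * (1 - t)) := by
  funext u
  have h1 : min 1 (1 - s + 3 * t) = 1 := min_eq_left (by linarith)
  have h2 : min 1 (1 - s + 3 * (1 - t)) = 1 - s + 3 * (1 - t) := min_eq_right (by linarith)
  have h3 : middle t s = 1 := by
    have : (1 : ℝ) ≤ (3 * t - s) / (3 - 2 * s) := by
      rw [le_div_iff₀ (by linarith)]
      linarith
    rw [middle, min_eq_left this, max_eq_right zero_le_one]
  rw [track, h1, h2, h3, retract_single, Pi.single_apply]
  split_ifs <;> ring

open Classical in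
theorem track_middle (p : T.CoEdge H) {t s : ℝ} (h : s ≤ 3 * t) (h' : s ≤ 3 * (1 - t)) :
    track p t s = fun u => (if u = p.1.1 then 1 - middle t s else 0) +
      if u = p.1.2 then middle t s else 0 := by
  funext u
  have h1 : min 1 (1 - s + 3 * t) = 1 := min_eq_left (by linarith)
  have h2 : min 1 (1 - s + 3 * (1 - t)) = 1 := min_eq_left (by linarith)
  rw [track, h1, h2, retract_single, retract_single, Pi.single_apply, Pi.single_apply]
  split_ifs <;> ring

theorem middle_mem (t s : ℝ) : 0 ≤ middle t s ∧ middle t s ≤ 1 :=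
  ⟨le_max_left _ _, max_le zero_le_one (min_le_left _ _)⟩

theorem exists_isClique_retract (hT : ∀ v, v ≠ T.root → H.Adj v (T.parent v)) {x : α → ℝ}
    {s : Finset α} (hx : IsBary x s) {l : ℝ} (h0 : 0 ≤ l) (h1 : l ≤ 1) :
    ∃ t, IsBary (T.retract x l) t ∧ H.IsClique (t : Set α) ∧ T.InTree t := by
  obtain ⟨v, -, h⟩ := retract_isBary (T := T) hx h0 h1
  refine ⟨{v, T.parent v}, h _ (by simp) (by simp), ?_, v, fun u hu => by simpa using hu⟩
  rw [Finset.coe_pair, SimpleGraph.isClique_pair]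
  refine fun hne => hT v fun hv => hne ?_
  rw [hv, T.parent_root]

theorem exists_isClique_track (hT : ∀ v, v ≠ T.root → H.Adj v (T.parent v)) (p : T.CoEdge H)
    {t s : ℝ} (ht0 : 0 ≤ t) (ht1 : t ≤ 1) (hs1 : s ≤ 1) :
    ∃ c, IsBary (track p t s) c ∧ H.IsClique (c : Set α) := by
  classical
  by_cases h : 3 * t ≤ s
  · rw [track_left p h hs1]
    obtain ⟨c, h1, h2, -⟩ := exists_isClique_retract hT (IsBary.single p.1.1)
      (l := 1 - s + 3 * t) (by linarith) (by linarith)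
    exact ⟨c, h1, h2⟩
  by_cases h' : 3 * (1 - t) ≤ s
  · rw [track_right p h' hs1]
    obtain ⟨c, h1, h2, -⟩ := exists_isClique_retract hT (IsBary.single p.1.2)
      (l := 1 - s + 3 * (1 - t)) (by linarith) (by linarith)
    exact ⟨c, h1, h2⟩
  · rw [track_middle p (not_le.1 h).le (not_le.1 h').le]
    obtain ⟨m0, m1⟩ := middle_mem t s
    refine ⟨p.ends, ⟨fun u => ?_, fun u hu => ?_, ?_⟩, p.isClique⟩
    · dsimp only
      split_ifs <;> linarith
    · simp only [CoEdge.ends, Finset.mem_insert, Finset.mem_singleton, not_or] at hu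
      simp [hu.1, hu.2]
    · rw [CoEdge.ends, Finset.sum_pair p.ne]
      simp [p.ne, p.ne.symm]

variable (T H) in
open Classical in
/-- The contraction of the tree in the graph. -/
noncomputable def contraction (x : α → ℝ) (s : ℝ) : α → ℝ :=
  if h : ∃ p : T.CoEdge H, 0 < x p.1.1 ∧ 0 < x p.1.2 then
    track h.choose (x h.choose.1.2) s
  else T.retract x (1 - s)

theorem contraction_of_inTree {s : Finset α} {x : α → ℝ} (hx : IsBary x s) (hs : T.InTree s)
    (r : ℝ) : T.contraction H x r = T.retract x (1 - r) :=
  dif_neg fun ⟨p, h1, h2⟩ => p.not_inTree hs (hx.mem_of_pos h1) (hx.mem_of_pos h2)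

/-- At the endpoints the definition uses the contraction of the tree; it agrees with the two
extremes of the track. -/
theorem contraction_of_coEdge (p : T.CoEdge H) {x : α → ℝ} (hx : IsBary x p.ends) {s : ℝ}
    (h0 : 0 ≤ s) (h1 : s ≤ 1) : T.contraction H x s = track p (x p.1.2) s := by
  classical
  rw [contraction]
  split_ifs with h
  · have := p.eq_of_mem h.choose (hx.mem_of_pos h.choose_spec.1) (hx.mem_of_pos h.choose_spec.2)
    rw [this]
  · have hsum := p.sum_ends hx
    by_cases hp : 0 < x p.1.1
    · have h2 : x p.1.2 = 0 := le_antisymm (not_lt.1 fun h2 => h ⟨p, hp, h2⟩) (hx.1 _)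
      have h3 : x = Pi.single p.1.1 1 := by
        funext u
        by_cases e1 : u = p.1.1
        · rw [e1, Pi.single_eq_same]
          linarith
        rw [Pi.single_eq_of_ne e1]
        by_cases e2 : u = p.1.2
        · rw [e2, h2]
        · exact p.eq_zero hx e1 e2
      rw [h2, track_left p (by linarith) h1, mul_zero, add_zero, ← h3]
    · have h2 : x p.1.1 = 0 := le_antisymm (not_lt.1 hp) (hx.1 _)
      have h2' : x p.1.2 = 1 := by linarith
      have h3 : x = Pi.single p.1.2 1 := by
        funext u
        by_cases e1 : u = p.1.2
        · rw [e1, Pi.single_eq_same, h2']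
        rw [Pi.single_eq_of_ne e1]
        by_cases e2 : u = p.1.1
        · rw [e2, h2]
        · exact p.eq_zero hx e2 e1
      rw [h2', track_right p (by linarith) h1, sub_self, mul_zero, add_zero, ← h3]

theorem track_zero (p : T.CoEdge H) {x : α → ℝ} (hx : IsBary x p.ends) :
    track p (x p.1.2) 0 = x := by
  have hsum := p.sum_ends hx
  have h1 := hx.1 p.1.1
  have h2 := hx.1 p.1.2
  have hm : middle (x p.1.2) 0 = x p.1.2 := by
    have : (3 * x p.1.2 - 0) / (3 - 2 * 0) = x p.1.2 := by ring
    rw [middle, this, min_eq_right (by linarith), max_eq_right h2]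
  rw [track_middle p (by linarith) (by linarith), hm]
  funext u
  by_cases e1 : u = p.1.1
  · subst e1
    simp only [if_true, p.ne, if_false]
    linarith
  by_cases e2 : u = p.1.2
  · subst e2
    simp [p.ne.symm]
  · simp [e1, e2, p.eq_zero hx e1 e2]

/-- Having one formula for all three pieces avoids gluing. The denominator in `middle` is at least
one, since the time is at most one. -/
theorem continuous_track (p : T.CoEdge H) {Z : Type*} [TopologicalSpace Z] {t s : Z → ℝ}
    (ht : Continuous t) (hs : Continuous s) (hs1 : ∀ z, s z ≤ 1) (u : α) :
    Continuous fun z => track p (t z) (s z) u := by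
  classical
  have hm : Continuous fun z => middle (t z) (s z) :=
    continuous_const.max (continuous_const.min
      (((continuous_const.mul ht).sub hs).div (continuous_const.sub (continuous_const.mul hs))
        fun z => by linarith [hs1 z]))
  have h1 : Continuous fun z => T.retract (Pi.single p.1.1 1) (min 1 (1 - s z + 3 * t z)) u :=
    continuous_retract (x := fun _ => Pi.single p.1.1 1) (fun _ => IsBary.single _)
      (fun _ => continuous_const)
      (continuous_const.min ((continuous_const.sub hs).add (continuous_const.mul ht)))
      (fun _ => min_le_left _ _) u
  have h2 : Continuous fun z =>
      T.retract (Pi.single p.1.2 1) (min 1 (1 - s z + 3 * (1 - t z))) u :=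
    continuous_retract (x := fun _ => Pi.single p.1.2 1) (fun _ => IsBary.single _)
      (fun _ => continuous_const)
      (continuous_const.min ((continuous_const.sub hs).add
        (continuous_const.mul (continuous_const.sub ht))))
      (fun _ => min_le_left _ _) u
  refine ((h1.add h2).sub ?_).sub ?_ <;> split_ifs <;>
    first | exact continuous_const | exact hm | exact continuous_const.sub hm

theorem track_eq_zero (p : T.CoEdge H) (t s : ℝ) {u : α}
    (hu : u ∉ insert T.root (T.ancestorsOf p.ends)) : track p t s u = 0 := by
  classical
  have hsub : ∀ a ∈ p.ends, u ∉ insert T.root (T.ancestorsOf {a}) := fun a ha h => by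
    refine hu ?_
    rw [Finset.mem_insert, mem_ancestorsOf] at h ⊢
    refine h.imp_right fun ⟨⟨w, hw, h⟩, h'⟩ => ⟨⟨w, ?_, h⟩, h'⟩
    rwa [Finset.mem_singleton.1 hw]
  have hne : ∀ a ∈ p.ends, u ≠ a := by
    rintro a ha rfl
    rw [Finset.mem_insert, mem_ancestorsOf, not_or] at hu
    exact hu.2 ⟨⟨u, ha, anc_refl u⟩, hu.1⟩
  have m1 : p.1.1 ∈ p.ends := by simp [CoEdge.ends]
  have m2 : p.1.2 ∈ p.ends := by simp [CoEdge.ends]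
  rw [track, retract_eq_zero (IsBary.single _) _ (hsub _ m1),
    retract_eq_zero (IsBary.single _) _ (hsub _ m2), if_neg (hne _ m1), if_neg (hne _ m2)]
  ring

end ParentTree

/-! ### Quotient maps that are homotopy equivalences -/

/-- Let `f` be a quotient map and `H` a homotopy from the identity such that `f ∘ H` and the final
map of `H` are constant on the fibres of `f`. Then `f` is a homotopy equivalence. -/
theorem homotopyEquiv_of_isQuotientMap {X Y : Type*} [TopologicalSpace X] [TopologicalSpace Y]
    (f : C(X, Y)) (hf : IsQuotientMap f) (H : C(X × I, X)) (h0 : ∀ x, H (x, 0) = x)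
    (hH : ∀ x y, f x = f y → ∀ s, f (H (x, s)) = f (H (y, s)))
    (h1 : ∀ x y, f x = f y → H (x, 1) = H (y, 1)) :
    Nonempty (ContinuousMap.HomotopyEquiv X Y) := by
  let H1 : C(X, X) := ⟨fun x => H (x, 1), H.continuous.comp (Continuous.prodMk_left 1)⟩
  let g : C(Y, X) := hf.lift H1 fun x y h => h1 x y h
  have hg : ∀ x, g (f x) = H (x, 1) := fun x =>
    congrArg (fun k : C(X, X) => k x) (hf.lift_comp H1 fun x y h => h1 x y h)
  -- The homotopy on `Y` is obtained by descending the curried map, so it is not necessary to know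
  -- that `f` times the interval is a quotient map.
  let K : C(X, C(I, Y)) := (f.comp H).curry
  have hK : Function.FactorsThrough K f := fun x y h => by
    ext s
    exact hH x y h s
  let L : C(Y, C(I, Y)) := hf.lift K hK
  have hL : ∀ x s, L (f x) s = f (H (x, s)) := fun x s =>
    congrArg (fun k : C(X, C(I, Y)) => k x s) (hf.lift_comp K hK)
  have hLc : Continuous fun p : I × Y => L p.2 p.1 :=
    (ContinuousMap.continuous_uncurry_of_continuous L).comp continuous_swap
  refine ⟨⟨f, g, ?_, ?_⟩⟩
  · refine ContinuousMap.Homotopic.symm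
      ⟨⟨⟨fun p => H (p.2, p.1), H.continuous.comp continuous_swap⟩, fun x => h0 x, fun x => ?_⟩⟩
    exact (hg x).symm
  · refine ContinuousMap.Homotopic.symm ⟨⟨⟨fun p => L p.2 p.1, hLc⟩, fun y => ?_, fun y => ?_⟩⟩
    · obtain ⟨x, rfl⟩ := hf.surjective y
      exact (hL x 0).trans (congrArg f (h0 x))
    · obtain ⟨x, rfl⟩ := hf.surjective y
      exact (hL x 1).trans (congrArg f (hg x).symm)

/-! ### A connected triangle-free graph is a wedge of circles up to homotopy -/

namespace ParentTree

variable {α : Type*} [LinearOrder α] {T : ParentTree α} {H : SimpleGraph α}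

theorem continuous_toWedge (hH : ∀ a b c, H.Adj a b → H.Adj b c → H.Adj a c → False) :
    Continuous fun x : H.CliqueSpace => T.toWedge H x.coord := by
  refine GeometricRealization.continuous_iff.2 fun s => ?_
  have hb := SimpleGraph.CliqueSpace.isBary_ofFace s
  rcases inTree_or_coEdge (T := T) hH s.2.1 s.2.2 with ht | ⟨p, hp⟩
  · have : (fun x : H.CliqueSpace => T.toWedge H x.coord) ∘ GeometricRealization.ofFace _ s =
        fun _ => WedgeOfCircles.base _ := funext fun y => toWedge_of_inTree (hb y) ht
    rw [this]
    exact continuous_const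
  · have : (fun x : H.CliqueSpace => T.toWedge H x.coord) ∘ GeometricRealization.ofFace _ s =
        fun y => WedgeOfCircles.circle p (Circle.exp (2 * Real.pi *
          (GeometricRealization.ofFace _ s y).coord p.1.2)) :=
      funext fun y => toWedge_of_coEdge p (hp ▸ hb y)
    rw [this]
    exact (WedgeOfCircles.continuous_circle p).comp (Circle.exp.continuous.comp
      (continuous_const.mul (GeometricRealization.continuous_coord_ofFace s _)))

/-- The point of an edge with given position. -/
noncomputable def edgePoint (p : T.CoEdge H) (t : I) : H.CliqueSpace :=
  .mk (fun u => (if u = p.1.1 then 1 - (t : ℝ) else 0) + if u = p.1.2 then (t : ℝ) else 0) (by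
    refine ⟨p.ends, ⟨fun u => ?_, fun u hu => ?_, ?_⟩, p.isClique⟩
    · have h0 := t.2.1
      have h1 := t.2.2
      dsimp only
      split_ifs <;> linarith
    · simp only [CoEdge.ends, Finset.mem_insert, Finset.mem_singleton, not_or] at hu
      simp [hu.1, hu.2]
    · rw [CoEdge.ends, Finset.sum_pair p.ne]
      simp [p.ne, p.ne.symm])

theorem continuous_edgePoint (p : T.CoEdge H) : Continuous (edgePoint p) := by
  refine GeometricRealization.continuous_of_finite_support p.ends (fun t u hu => ?_) fun u => ?_
  · simp only [CoEdge.ends, Finset.mem_insert, Finset.mem_singleton, not_or] at hu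
    simp [edgePoint, SimpleGraph.CliqueSpace.mk, hu.1, hu.2]
  · refine Continuous.add ?_ ?_ <;> split_ifs <;>
      first | exact continuous_const | exact continuous_const.sub continuous_subtype_val |
        exact continuous_subtype_val

theorem isBary_edgePoint (p : T.CoEdge H) (t : I) : IsBary (edgePoint p t).coord p.ends := by
  have h0 : ∀ u, u ∉ p.ends → (edgePoint p t).coord u = 0 := fun u hu => by
    simp only [CoEdge.ends, Finset.mem_insert, Finset.mem_singleton, not_or] at hu
    simp [edgePoint, SimpleGraph.CliqueSpace.mk, hu.1, hu.2]
  exact ⟨(edgePoint p t).nonneg, h0, (edgePoint p t).sum_coord_eq_one h0⟩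

/-- Precomposition with the parametrization of the edges outside the tree, together with a point for
the root, gives the quotient map `ofInterval`; a continuous map is a quotient map if such a
composite is. -/
theorem isQuotientMap_toWedge (hH : ∀ a b c, H.Adj a b → H.Adj b c → H.Adj a c → False) :
    IsQuotientMap fun x : H.CliqueSpace => T.toWedge H x.coord := by
  let x₀ : H.CliqueSpace :=
    .mk (Pi.single T.root 1) ⟨{T.root}, IsBary.single _, by simp⟩
  let Q : Unit ⊕ (Σ _ : T.CoEdge H, I) → H.CliqueSpace :=
    Sum.elim (fun _ => x₀) fun q => edgePoint q.1 q.2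
  have hQ : Continuous Q := continuous_sum_dom.2
    ⟨continuous_const, continuous_sigma fun p => continuous_edgePoint p⟩
  refine IsQuotientMap.of_comp hQ (continuous_toWedge hH) ?_
  have : (fun x : H.CliqueSpace => T.toWedge H x.coord) ∘ Q =
      WedgeOfCircles.ofInterval (T.CoEdge H) := by
    funext q
    rcases q with q | ⟨p, t⟩
    · exact toWedge_of_inTree (IsBary.single _) ⟨T.root, by simp⟩
    · refine (toWedge_of_coEdge p (isBary_edgePoint p t)).trans ?_
      have : (edgePoint p t).coord p.1.2 = t := by
        simp [edgePoint, SimpleGraph.CliqueSpace.mk, p.ne.symm]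
      rw [this]
      rfl
  rw [this]
  exact WedgeOfCircles.isQuotientMap_ofInterval

/-- A point lies in the tree or in the interior of an edge outside of the tree. -/
theorem inTree_or_interior (hH : ∀ a b c, H.Adj a b → H.Adj b c → H.Adj a c → False)
    (x : H.CliqueSpace) : (∃ s, IsBary x.coord s ∧ T.InTree s) ∨
      ∃ p : T.CoEdge H, IsBary x.coord p.ends ∧ 0 < x.coord p.1.2 ∧ x.coord p.1.2 < 1 := by
  obtain ⟨s, hs, hpos, hb⟩ := x.exists_clique
  rcases inTree_or_coEdge (T := T) hH hb.nonempty hs with ht | ⟨p, rfl⟩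
  · exact Or.inl ⟨s, hb, ht⟩
  · have h1 := (hpos p.1.1).1 (by simp [CoEdge.ends])
    have h2 := (hpos p.1.2).1 (by simp [CoEdge.ends])
    have := p.sum_ends hb
    exact Or.inr ⟨p, hb, h2, by linarith⟩

/-- The collapsing map identifies only points of the tree. -/
theorem eq_or_inTree_of_toWedge_eq (hH : ∀ a b c, H.Adj a b → H.Adj b c → H.Adj a c → False)
    {x y : H.CliqueSpace} (h : T.toWedge H x.coord = T.toWedge H y.coord) :
    x = y ∨ (∃ s, IsBary x.coord s ∧ T.InTree s) ∧ ∃ s, IsBary y.coord s ∧ T.InTree s := by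
  rcases inTree_or_interior (T := T) hH x with ⟨s, hs, ht⟩ | ⟨p, hp, hp0, hp1⟩ <;>
    rcases inTree_or_interior (T := T) hH y with ⟨s', hs', ht'⟩ | ⟨q, hq, hq0, hq1⟩
  · exact Or.inr ⟨⟨s, hs, ht⟩, s', hs', ht'⟩
  · have := congrArg WedgeOfCircles.position h
    rw [toWedge_of_inTree hs ht, toWedge_of_coEdge q hq, WedgeOfCircles.position_base,
      WedgeOfCircles.position_circle (exp_two_pi_mul_ne_one hq0 hq1)] at this
    exact absurd this (by simp)
  · have := congrArg WedgeOfCircles.position h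
    rw [toWedge_of_inTree hs' ht', toWedge_of_coEdge p hp, WedgeOfCircles.position_base,
      WedgeOfCircles.position_circle (exp_two_pi_mul_ne_one hp0 hp1)] at this
    exact absurd this (by simp)
  · have := congrArg WedgeOfCircles.position h
    rw [toWedge_of_coEdge q hq, toWedge_of_coEdge p hp,
      WedgeOfCircles.position_circle (exp_two_pi_mul_ne_one hp0 hp1),
      WedgeOfCircles.position_circle (exp_two_pi_mul_ne_one hq0 hq1), Option.some_inj,
      Prod.mk.injEq] at this
    obtain ⟨rfl, he⟩ := this
    have h2 := exp_two_pi_mul_inj hp0 hp1 hq0 hq1 he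
    have h1 := p.sum_ends hp
    have h1' := p.sum_ends hq
    left
    ext u
    by_cases e1 : u = p.1.1
    · rw [e1]
      linarith
    by_cases e2 : u = p.1.2
    · rw [e2, h2]
    · rw [p.eq_zero hp e1 e2, p.eq_zero hq e1 e2]

theorem exists_isClique_contraction (hH : ∀ a b c, H.Adj a b → H.Adj b c → H.Adj a c → False)
    (hT : ∀ v, v ≠ T.root → H.Adj v (T.parent v)) (x : H.CliqueSpace) (s : I) :
    ∃ c, IsBary (T.contraction H x.coord s) c ∧ H.IsClique (c : Set α) := by
  have s0 := s.2.1
  have s1 := s.2.2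
  rcases inTree_or_interior (T := T) hH x with ⟨c, hc, ht⟩ | ⟨p, hp, hp0, hp1⟩
  · rw [contraction_of_inTree hc ht]
    obtain ⟨d, h1, h2, -⟩ := exists_isClique_retract hT hc (l := 1 - s) (by linarith)
      (by linarith)
    exact ⟨d, h1, h2⟩
  · rw [contraction_of_coEdge p hp s0 s1]
    exact exists_isClique_track hT p hp0.le hp1.le s1

/-- A connected triangle-free graph, considered as a one-dimensional complex, is homotopy
equivalent to the wedge of the circles given by the edges outside of a spanning tree. -/
theorem homotopyEquiv_wedge (hH : ∀ a b c, H.Adj a b → H.Adj b c → H.Adj a c → False)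
    (hT : ∀ v, v ≠ T.root → H.Adj v (T.parent v)) :
    Nonempty (ContinuousMap.HomotopyEquiv H.CliqueSpace (WedgeOfCircles (T.CoEdge H))) := by
  let F : H.CliqueSpace × I → H.CliqueSpace := fun q =>
    .mk (T.contraction H q.1.coord q.2) (exists_isClique_contraction hH hT q.1 q.2)
  have hF : Continuous F := GeometricRealization.continuous_prod fun s => by
    have hb := SimpleGraph.CliqueSpace.isBary_ofFace s
    have hcont := GeometricRealization.continuous_coord_ofFace s
    have hsnd : Continuous fun z : stdSimplex ℝ s.1 × I => (z.2 : ℝ) :=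
      continuous_subtype_val.comp continuous_snd
    rcases inTree_or_coEdge (T := T) hH s.2.1 s.2.2 with ht | ⟨p, hp⟩
    · have key : ∀ z : stdSimplex ℝ s.1 × I, (F (GeometricRealization.ofFace _ s z.1, z.2)).coord =
          T.retract (GeometricRealization.ofFace _ s z.1).coord (1 - z.2) := fun z =>
        contraction_of_inTree (hb z.1) ht z.2
      refine GeometricRealization.continuous_of_finite_support
        (insert T.root (T.ancestorsOf s.1)) (fun z u hu => ?_) fun u => ?_
      · rw [key]
        exact retract_eq_zero (hb z.1) _ hu
      · simp only [key]
        exact continuous_retract (Z := stdSimplex ℝ s.1 × I)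
          (x := fun z => (GeometricRealization.ofFace _ s z.1).coord) (l := fun z => 1 - (z.2 : ℝ))
          (fun z => hb z.1) (fun v => (hcont v).comp continuous_fst)
          (continuous_const.sub hsnd) (fun z => sub_le_self 1 z.2.2.1) u
    · have key : ∀ z : stdSimplex ℝ s.1 × I, (F (GeometricRealization.ofFace _ s z.1, z.2)).coord =
          track p ((GeometricRealization.ofFace _ s z.1).coord p.1.2) z.2 := fun z =>
        contraction_of_coEdge p (hp ▸ hb z.1) z.2.2.1 z.2.2.2
      refine GeometricRealization.continuous_of_finite_support
        (insert T.root (T.ancestorsOf p.ends)) (fun z u hu => ?_) fun u => ?_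
      · rw [key]
        exact track_eq_zero p _ _ hu
      · simp only [key]
        exact continuous_track p ((hcont _).comp continuous_fst) hsnd (fun z => z.2.2.2) u
  have hFtree : ∀ x : H.CliqueSpace, ∀ c, IsBary x.coord c → T.InTree c → ∀ s : I,
      (F (x, s)).coord = T.retract x.coord (1 - s) := fun x c hc ht s =>
    contraction_of_inTree hc ht s
  have hbase : ∀ x : H.CliqueSpace, (∃ c, IsBary x.coord c ∧ T.InTree c) → ∀ s : I,
      T.toWedge H (F (x, s)).coord = WedgeOfCircles.base _ := by
    rintro x ⟨c, hc, ht⟩ s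
    have s0 := s.2.1
    have s1 := s.2.2
    rw [hFtree x c hc ht]
    obtain ⟨d, h1, -, h2⟩ := exists_isClique_retract hT hc (l := 1 - s) (by linarith)
      (by linarith)
    exact toWedge_of_inTree h1 h2
  -- Two distinct points with the same image both lie in the tree. The contraction keeps them in the
  -- tree, which goes to the base point, and at time one moves both to the root.
  refine homotopyEquiv_of_isQuotientMap ⟨_, continuous_toWedge hH⟩ (isQuotientMap_toWedge hH)
    ⟨F, hF⟩ (fun x => ?_) (fun x y h s => ?_) fun x y h => ?_
  · apply GeometricRealization.ext
    rcases inTree_or_interior (T := T) hH x with ⟨c, hc, ht⟩ | ⟨p, hp, -, -⟩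
    · refine (hFtree x c hc ht 0).trans ?_
      rw [Set.Icc.coe_zero, sub_zero]
      obtain ⟨a, ha⟩ := ht
      exact retract_one hc (v := a) fun u h1 h2 => hc.2.1 u fun hu => (ha u hu).elim h1 h2
    · exact (contraction_of_coEdge p hp le_rfl zero_le_one).trans (track_zero p hp)
  · rcases eq_or_inTree_of_toWedge_eq hH h with rfl | ⟨hx, hy⟩
    · rfl
    · exact (hbase x hx s).trans (hbase y hy s).symm
  · rcases eq_or_inTree_of_toWedge_eq hH h with rfl | ⟨⟨c, hc, ht⟩, ⟨d, hd, ht'⟩⟩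
    · rfl
    · apply GeometricRealization.ext
      refine (hFtree x c hc ht 1).trans (Eq.trans ?_ (hFtree y d hd ht' 1).symm)
      rw [Set.Icc.coe_one, sub_self, retract_zero, retract_zero]

end ParentTree

/-! ### Stars, links and triangles of a wheel-free graph -/

namespace SimpleGraph

variable {V : Type*} (G : SimpleGraph V)

/-- The edges of `G` at `v`. -/
def edgeStar (v : V) : Set G.edgeSet := {e | v ∈ e.1}

/-- The link of `v`, as a graph on the edges of `G`: two edges at `v` are joined if their other
endpoints are adjacent. -/
def linkGraph (v : V) : SimpleGraph G.edgeSet where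
  Adj e f := ∃ a b, G.Adj a b ∧ e.1 = s(v, a) ∧ f.1 = s(v, b)
  symm := ⟨fun _ _ ⟨a, b, h, he, hf⟩ => ⟨b, a, h.symm, hf, he⟩⟩
  loopless := ⟨fun _ ⟨_, _, h, he, hf⟩ => h.ne (Sym2.congr_right.1 (he.symm.trans hf))⟩

variable {G}

/-- The other endpoints of the edges on a cycle in the link form a cycle of neighbours of `v`: a
wheel with hub `v`. -/
theorem WheelFree.isAcyclic_linkGraph (hG : G.WheelFree) (v : V) : (G.linkGraph v).IsAcyclic := by
  rw [isAcyclic_iff_free_cycleGraph]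
  rintro n hn ⟨φ⟩
  refine hG n hn ?_
  -- The link graph has all edges of `G` as vertices, those away from `v` being isolated. Being
  -- adjacent to the next vertex of the cycle places `φ i` at `v`.
  have hex : ∀ i, ∃ a, (φ i).1 = s(v, a) := fun i => by
    obtain ⟨m, rfl⟩ : ∃ m, n = m + 2 := ⟨n - 2, by omega⟩
    have hadj : (cycleGraph (m + 2)).Adj i (i + 1) := by
      rw [cycleGraph_adj]
      right
      simp
    obtain ⟨a, b, -, h, -⟩ := φ.toHom.map_adj hadj
    exact ⟨a, h⟩
  choose a ha using hex
  have hva : ∀ i, G.Adj v (a i) := fun i => by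
    have := (φ i).2
    rwa [ha i] at this
  refine ⟨⟨⟨fun o => o.elim v a, ?_⟩, ?_⟩⟩
  · rintro (_ | i) (_ | j) h
    · exact h.elim
    · exact hva j
    · exact (hva i).symm
    · obtain ⟨c, d, hcd, h1, h2⟩ := φ.toHom.map_adj (show (cycleGraph n).Adj i j from h)
      have e1 : a i = c := Sym2.congr_right.1 ((ha i).symm.trans h1)
      have e2 : a j = d := Sym2.congr_right.1 ((ha j).symm.trans h2)
      change G.Adj (a i) (a j)
      rwa [e1, e2]
  · rintro (_ | i) (_ | j) h
    · rfl
    · exact absurd h (hva j).ne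
    · exact absurd h (hva i).ne'
    · have : φ i = φ j := Subtype.ext ((ha i).trans ((congrArg (fun c => s(v, c)) h).trans
        (ha j).symm))
      rw [φ.injective this]

/-- An acyclic link extends to a tree on the star of the vertex. -/
theorem exists_parentTree_of_isAcyclic {v : V} (h : (G.linkGraph v).IsAcyclic)
    (hv : (G.edgeStar v).Nonempty) : ∃ T : ParentTree G.edgeSet, T.root ∈ G.edgeStar v ∧
      (∀ e ∈ G.edgeStar v, T.parent e ∈ G.edgeStar v) ∧
      ∀ e f, (G.linkGraph v).Adj e f → T.parent e = f ∨ T.parent f = e := by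
  obtain ⟨r, hr⟩ := hv
  -- `K` is complete on the star, and every edge outside the star is joined only to `r`. A spanning
  -- tree of `K` rooted at `r` that contains the link therefore has parents of star elements in the
  -- star.
  let K : SimpleGraph G.edgeSet :=
    { Adj := fun e f => e ≠ f ∧ (e ∈ G.edgeStar v ∧ f ∈ G.edgeStar v ∨ e = r ∨ f = r)
      symm := ⟨fun _ _ h => ⟨h.1.symm, h.2.imp And.symm Or.symm⟩⟩
      loopless := ⟨fun _ h => h.1 rfl⟩ }
  have hK : K.Connected := by
    have : Nonempty G.edgeSet := ⟨r⟩
    have key : ∀ e, K.Reachable e r := fun e => by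
      by_cases he : e = r
      · rw [he]
      · exact Adj.reachable ⟨he, Or.inr (Or.inr rfl)⟩
    exact ⟨fun e f => (key e).trans (key f).symm⟩
  have hle : G.linkGraph v ≤ K := fun e f h => by
    refine ⟨h.ne, Or.inl ?_⟩
    obtain ⟨a, b, -, he, hf⟩ := h
    exact ⟨by simp [edgeStar, he], by simp [edgeStar, hf]⟩
  obtain ⟨T, hFT, hTK, hT⟩ := hK.exists_isTree_le_of_le_of_isAcyclic hle h
  obtain ⟨P, hroot, hadj, hP⟩ := ParentTree.exists_of_connected hT.1 r
  refine ⟨P, hroot ▸ hr, fun e he => ?_, fun e f h => hP hT.2 e f (hFT h)⟩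
  by_cases her : e = r
  · rw [her, ← hroot, P.parent_root, hroot]
    exact hr
  · rcases (hTK (hadj e her)).2 with h | h | h
    · exact h.2
    · exact absurd h her
    · rw [h]
      exact hr

/-- An edge is determined by two distinct endpoints. -/
theorem edgeStar_eq {v w : V} {e f : G.edgeSet} (hne : e ≠ f) (h1 : e ∈ G.edgeStar v)
    (h2 : f ∈ G.edgeStar v) (h3 : e ∈ G.edgeStar w) (h4 : f ∈ G.edgeStar w) : v = w := by
  by_contra hvw
  exact hne (Subtype.ext (((Sym2.mem_and_mem_iff hvw).1 ⟨h1, h3⟩).trans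
    ((Sym2.mem_and_mem_iff hvw).1 ⟨h2, h4⟩).symm))

theorem exists_starSystem (hG : ∀ v, (G.linkGraph v).IsAcyclic)
    (hne : ∀ v, (G.edgeStar v).Nonempty) : ∃ S : StarSystem V G.edgeSet, S.star = G.edgeStar ∧
      ∀ v e f, (G.linkGraph v).Adj e f → (S.tree v).parent e = f ∨ (S.tree v).parent f = e := by
  choose T h1 h2 h3 using fun v => exists_parentTree_of_isAcyclic (hG v) (hne v)
  exact ⟨⟨G.edgeStar, T, h1, h2, edgeStar_eq⟩, rfl, h3⟩

theorem starSystem_lineGraph {S : StarSystem V G.edgeSet} (hS : S.star = G.edgeStar) :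
    S.lineGraph = G.lineGraph := by
  ext e f
  rw [lineGraph_adj_iff_exists]
  simp [StarSystem.lineGraph, hS, edgeStar]

/-- The three pairwise common endpoints are distinct, since a coincidence would put all three edges
into one star. -/
theorem exists_of_isTriangle {S : StarSystem V G.edgeSet} (hS : S.star = G.edgeStar)
    {e f g : G.edgeSet} (h : S.IsTriangle e f g) :
    ∃ a b c, e.1 = s(a, b) ∧ f.1 = s(b, c) ∧ g.1 = s(a, c) := by
  obtain ⟨⟨-, b, hb1, hb2⟩, ⟨-, c, hc1, hc2⟩, ⟨-, a, ha1, ha2⟩, hn⟩ := h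
  have hab : a ≠ b := by
    rintro rfl
    exact hn ⟨a, ha1, hb2, ha2⟩
  have hbc : b ≠ c := by
    rintro rfl
    exact hn ⟨b, hb1, hb2, hc2⟩
  have hac : a ≠ c := by
    rintro rfl
    exact hn ⟨a, ha1, hc1, ha2⟩
  rw [hS] at *
  exact ⟨a, b, c, (Sym2.mem_and_mem_iff hab).1 ⟨ha1, hb1⟩, (Sym2.mem_and_mem_iff hbc).1 ⟨hb2, hc1⟩,
    (Sym2.mem_and_mem_iff hac).1 ⟨ha2, hc2⟩⟩

/-- Two sides of a triangle determine the third. They are joined in the link of their common corner,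
precisely because the third side is an edge of `G`, and so they form a tree edge. Pairwise meeting
edges have a common vertex or form a triangle. -/
theorem starSystem_regular [Nonempty V] {S : StarSystem V G.edgeSet} (hS : S.star = G.edgeStar)
    (hT : ∀ v e f, (G.linkGraph v).Adj e f →
      (S.tree v).parent e = f ∨ (S.tree v).parent f = e) : S.Regular := by
  have hmem : ∀ v (e : G.edgeSet), e ∈ S.star v ↔ v ∈ e.1 := fun v e => by rw [hS]; rfl
  refine ⟨fun {e f g g'} h h' => ?_, fun {e f g} h => ?_, fun s hs => ?_⟩
  · obtain ⟨a, b, c, he, hf, hg⟩ := exists_of_isTriangle hS h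
    obtain ⟨a', b', c', he', hf', hg'⟩ := exists_of_isTriangle hS h'
    have hb : b = b' := S.star_eq h.1.1 ((hmem _ _).2 (by simp [he])) ((hmem _ _).2 (by simp [hf]))
      ((hmem _ _).2 (by simp [he'])) ((hmem _ _).2 (by simp [hf']))
    subst hb
    have ha : a = a' := Sym2.congr_left.1 (he.symm.trans he')
    have hc : c = c' := Sym2.congr_right.1 (hf.symm.trans hf')
    exact Subtype.ext (by rw [hg, hg', ha, hc])
  · obtain ⟨a, b, c, he, hf, hg⟩ := exists_of_isTriangle hS h
    refine ⟨h.1.1, b, (hmem _ _).2 (by simp [he]), (hmem _ _).2 (by simp [hf]), hT b e f ?_⟩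
    refine ⟨a, c, ?_, he.trans Sym2.eq_swap, hf⟩
    have := g.2
    rwa [hg] at this
  · by_contra! hn
    obtain ⟨hn1, hn2⟩ := hn
    have meet : ∀ d ∈ s, ∀ e ∈ s, d ≠ e → ∃ v, v ∈ d.1 ∧ v ∈ e.1 := fun d hd e he hne => by
      obtain ⟨-, v, h1, h2⟩ := hs hd he hne
      exact ⟨v, (hmem _ _).1 h1, (hmem _ _).1 h2⟩
    -- Any member of `s` serves as the first side. A member missing `a` must contain `b`, one
    -- missing `b` must contain `a`, and these two meet in the third corner `c`.
    obtain ⟨e, he, -⟩ := hn1 (Classical.arbitrary V)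
    obtain ⟨⟨a, b⟩, hab⟩ := e
    obtain ⟨f, hf, haf⟩ := hn1 a
    obtain ⟨g, hg, hbg⟩ := hn1 b
    rw [hmem] at haf hbg
    have hef : (⟨s(a, b), hab⟩ : G.edgeSet) ≠ f := by
      rintro rfl
      simp at haf
    have heg : (⟨s(a, b), hab⟩ : G.edgeSet) ≠ g := by
      rintro rfl
      simp at hbg
    have hbf : b ∈ f.1 := by
      obtain ⟨v, h1, h2⟩ := meet _ he f hf hef
      rcases Sym2.mem_iff.1 h1 with rfl | rfl
      · exact absurd h2 haf
      · exact h2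
    have hag : a ∈ g.1 := by
      obtain ⟨v, h1, h2⟩ := meet _ he g hg heg
      rcases Sym2.mem_iff.1 h1 with rfl | rfl
      · exact h2
      · exact absurd h2 hbg
    have hfg : f ≠ g := by
      rintro rfl
      exact haf hag
    obtain ⟨c, hcf, hcg⟩ := meet f hf g hg hfg
    have hca : a ≠ c := by
      rintro rfl
      exact haf hcf
    have hcb : b ≠ c := by
      rintro rfl
      exact hbg hcg
    have hab' : a ≠ b := (show G.Adj a b from hab).ne
    have hf' := (Sym2.mem_and_mem_iff hcb).1 ⟨hbf, hcf⟩
    have hg' := (Sym2.mem_and_mem_iff hca).1 ⟨hag, hcg⟩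
    refine hn2 _ f g ⟨hs he hf hef, hs hf hg hfg, hs he hg heg, ?_⟩ |>.elim fun d hd => ?_
    · rintro ⟨v, h1, h2, h3⟩
      rw [hmem] at h1 h2 h3
      rcases Sym2.mem_iff.1 h1 with rfl | rfl
      · exact haf h2
      · exact hbg h3
    · rcases hd with ⟨hd, d1, d2, d3⟩ | ⟨hd, h⟩
      -- An edge that meets all three sides contains two of the corners, so it is itself a side.
      · obtain ⟨u, hu1, hu2⟩ := meet d hd _ he d1
        obtain ⟨w, hw1, hw2⟩ := meet d hd f hf d2
        obtain ⟨z, hz1, hz2⟩ := meet d hd g hg d3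
        rw [hf'] at hw2
        rw [hg'] at hz2
        have hsub : ∀ x y, x ≠ y → x ∈ d.1 → y ∈ d.1 → d.1 = s(x, y) := fun x y h h1 h2 =>
          (Sym2.mem_and_mem_iff h).1 ⟨h1, h2⟩
        have n1 : ¬ (a ∈ d.1 ∧ b ∈ d.1) := fun h => d1 (Subtype.ext (hsub a b hab' h.1 h.2))
        have n2 : ¬ (b ∈ d.1 ∧ c ∈ d.1) := fun h =>
          d2 (Subtype.ext ((hsub b c hcb h.1 h.2).trans hf'.symm))
        have n3 : ¬ (a ∈ d.1 ∧ c ∈ d.1) := fun h =>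
          d3 (Subtype.ext ((hsub a c hca h.1 h.2).trans hg'.symm))
        rcases Sym2.mem_iff.1 hu2 with rfl | rfl
        · rcases Sym2.mem_iff.1 hw2 with rfl | rfl
          · exact n1 ⟨hu1, hw1⟩
          · exact n3 ⟨hu1, hw1⟩
        · rcases Sym2.mem_iff.1 hz2 with rfl | rfl
          · exact n1 ⟨hz1, hu1⟩
          · exact n2 ⟨hu1, hz1⟩
      · rcases h with rfl | rfl | rfl
        · exact hd he
        · exact hd hf
        · exact hd hg

theorem Connected.edgeStar_nonempty [Nontrivial V] (hG : G.Connected) (v : V) :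
    (G.edgeStar v).Nonempty := by
  obtain ⟨w, hw⟩ := exists_ne v
  obtain ⟨p⟩ := hG.preconnected v w
  cases p with
  | nil => exact absurd rfl hw
  | cons h _ => exact ⟨⟨s(v, _), h⟩, Sym2.mem_mk_left _ _⟩

theorem Connected.lineGraph_connected [Nontrivial V] (hG : G.Connected) :
    G.lineGraph.Connected := by
  have star : ∀ v e f, e ∈ G.edgeStar v → f ∈ G.edgeStar v → G.lineGraph.Reachable e f :=
    fun v e f he hf => by
      by_cases h : e = f
      · rw [h]
      · exact Adj.reachable (lineGraph_adj_iff_exists.2 ⟨h, v, he, hf⟩)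
  have key : ∀ v w, G.Walk v w → ∀ e f, e ∈ G.edgeStar v → f ∈ G.edgeStar w →
      G.lineGraph.Reachable e f := by
    intro v w p
    induction p with
    | nil => exact star _
    | @cons v u w h _ ih =>
      intro e f he hf
      exact (star v e ⟨s(v, u), h⟩ he (Sym2.mem_mk_left _ _)).trans
        (ih _ f (Sym2.mem_mk_right _ _) hf)
  obtain ⟨v⟩ := hG.nonempty
  have : Nonempty G.edgeSet := ⟨(hG.edgeStar_nonempty v).some⟩
  refine ⟨fun e f => ?_⟩
  have he : e.1.out.1 ∈ e.1 := Sym2.out_fst_mem _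
  have hf : f.1.out.1 ∈ f.1 := Sym2.out_fst_mem _
  obtain ⟨p⟩ := hG.preconnected e.1.out.1 f.1.out.1
  exact key _ _ p e f he hf

end SimpleGraph

/-! ### Assembling the homotopy equivalences -/

theorem mainTheorem2 {V : Type u} [Nontrivial V] (G : SimpleGraph V) (hconn : G.Connected)
    (hwheel : G.WheelFree) :
    ∃ ι : Type u, Nonempty (ContinuousMap.HomotopyEquiv G.DeltaL (WedgeOfCircles ι)) := by
  obtain ⟨S, hS, hT⟩ := SimpleGraph.exists_starSystem hwheel.isAcyclic_linkGraph
    hconn.edgeStar_nonempty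
  have hreg := SimpleGraph.starSystem_regular hS hT
  have hL := SimpleGraph.starSystem_lineGraph hS
  -- An arbitrary linear order selects the side to remove from every triangle and orients the edges
  -- outside the spanning tree.
  let _ : LinearOrder G.edgeSet := IsWellOrder.linearOrder WellOrderingRel
  have hC : S.collapsedGraph.Connected :=
    StarSystem.collapsedGraph_connected hreg (hL ▸ hconn.lineGraph_connected)
  obtain ⟨r⟩ := hC.nonempty
  obtain ⟨T, rfl, hadj, -⟩ := ParentTree.exists_of_connected hC r
  obtain ⟨e₁⟩ := StarSystem.homotopyEquiv_treeGraph hreg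
  obtain ⟨e₂⟩ := StarSystem.homotopyEquiv_collapsedGraph hreg
  obtain ⟨e₃⟩ := ParentTree.homotopyEquiv_wedge
    (fun _ _ _ => StarSystem.collapsedGraph_not_triangle) hadj
  rw [hL] at e₁
  exact ⟨_, ⟨(e₁.trans e₂).trans e₃⟩⟩
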